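/- Setting. Let $T\ge 0$ and $d_{\mathcal S},d_{\mathcal A},d\ge 1$ be integers. For $t=0,\dots,T$ let $\mathcal S_t\subseteq\mathbb R^{d_{\mathcal S}}$ and $\mathcal A_t\subseteq\mathbb R^{d_{\mathcal A}}$ be compact sets, each contained in a closed Euclidean ball of radius $R\ge 0$, and let $c_t:\mathcal S_t\times\mathcal A_t\to[0,1]$ be continuous. For $t=0,\dots,T-1$ let $\Xi_t$ be a topological space with a $\sigma$-algebra containing its open sets, $P_t$ a probability measure on $\Xi_t$, and $F_t:\mathcal S_t\times\mathcal A_t\times\Xi_t\to\mathcal S_{t+1}$ a continuous map. Assume that there is $L\ge 0$ such that for all $s,s'\in\mathcal S_t$, $a,a'\in\mathcal A_t$, $\xi\in\Xi_t$, $$|c_t(s,a)-c_t(s',a')|\le L\|(s,a)-(s',a')\|\ (t\le T),\qquad \|F_t(s,a,\xi)-F_t(s',a',\xi)\|\le L\|(s,a)-(s',a')\|\ (t<T),$$ where $\|\cdot\|$ is the Euclidean norm. Let $\Theta\subseteq\mathbb R^d$ be non-empty and contained in a closed ball of radius $R_\Theta\ge 0$, and let $f_\theta:\mathbb R\to\mathbb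 R$ satisfy $|f_\theta(z)-f_\theta(z')|\le L_C|z-z'|$ and $|f_\theta(z)-f_{\theta'}(z)|\le L_\Theta\|\theta-\theta'\|$ for all $\theta,\theta'\in\Theta$, $z,z'\in\mathbb R$, where $L_C,L_\Theta\ge 0$. Let $\pi=(\pi_t)_{t=0}^T$ be a randomized Markov policy on the augmented state space, i.e. each $\pi_t(\cdot\,|\,s,x)$ is a Markov kernel from $\mathcal S_t\times\mathbb R$ to $\mathcal A_t$, and assume that it is $L^\pi$-Lipschitz ($L^\pi\ge 0$): $$\|\pi_t(\cdot|s,x)-\pi_t(\cdot|s',x')\|_1\le L^\pi\|(s,x)-(s',x')\|\qquad\text{for all } t\le T,\ s,s'\in\mathcal S_t,\ x,x'\in\mathbb R,$$ where $\|\mu-\nu\|_1$ is the total mass of $|\mu-\nu|$. For $s\in\mathcal S_0$ and noise laws $P=(P_t)_{t<T}$ let $(S_t,A_t)_{t=0}^T$ be the process with $S_0=s$, $X_t=\sum_{i<t}c_i(S_i,A_i)$, $A_t\sim\pi_t(\cdot|S_t,X_t)$, $S_{t+1}=F_t(S_t,A_t,\xi_t)$, where $\xi_t\sim P_t$ is independent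 of $(S_0,A_0,\dots,S_t,A_t)$, and let $$\mathcal R^\pi(s)=\inf_{\theta\in\Theta}\mathbb E^\pi_P\Big[f_\theta\Big(\sum_{t=0}^Tc_t(S_t,A_t)\Big)\Big].$$ Given, for each $t<T$, $n$ i.i.d. samples from $P_t$, let $\hat{\mathcal R}^\pi_n(s)$ be the same quantity with every $P_t$ replaced by the empirical distribution of its $n$ samples. Theorem. There is a universal constant $C>0$ such that, in every such setting and for every $\epsilon>0$, $\delta\in(0,1)$ and every integer $n\ge 1$ with $$n\ \ge\ C\,\frac{T^5L_C^2\,d_{\mathcal S}\,d_{\mathcal A}\,d}{\epsilon^2}\,\log\max\Big\{2,\ \frac{T\,\bar L_C\,\bar L_\Theta\,\bar L\,\bar L^\pi\,\bar R\,\bar R_\Theta}{\epsilon\,\delta}\Big\},\qquad \bar y:=\max\{1,y\},$$ one has, with probability at least $1-\delta$ over the samples, $$|\mathcal R^\pi(s)-\hat{\mathcal R}^\pi_n(s)|\le\epsilon\qquad\text{for all } s\in\mathcal S_0 .$$ -/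

import Mathlib

open MeasureTheory ProbabilityTheory
open scoped ENNReal

/-- The data of a stochastic optimal control problem: at stage `t` the state space `S t ⊆ ℝ^dS`, the
action space `A t ⊆ ℝ^dA`, the continuous cost `c t` and the continuous transition function
`F t`, which is driven by a noise variable with values in `Ξ t`.  A problem of horizon `T` uses
`S t`, `A t`, `c t` for `t ≤ T` and `F t`, `Ξ t` for `t < T`; the later stages never enter. -/
structure SOC (dS dA : ℕ) (Ξ : ℕ → Type*) [∀ t, TopologicalSpace (Ξ t)] where
  S : ℕ → Set (EuclideanSpace ℝ (Fin dS))
  A : ℕ → Set (EuclideanSpace ℝ (Fin dA))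
  c : ∀ t, S t × A t → ℝ
  F : ∀ t, (S t × A t) × Ξ t → S (t + 1)
  continuous_c : ∀ t, Continuous (c t)
  continuous_F : ∀ t, Continuous (F t)

namespace SOC

variable {dS dA : ℕ} {Ξ : ℕ → Type*} [∀ t, TopologicalSpace (Ξ t)]

/-- Histories `(s₀, a₀, …, sₙ, aₙ)` of states and actions up to stage `n`. -/
abbrev Hist (M : SOC dS dA Ξ) (n : ℕ) : Type := (i : Finset.Iic n) → M.S i × M.A i

/-- The cost `∑_{i ≤ n} c_i(s_i, a_i)` accumulated along a history. -/
noncomputable def accCost (M : SOC dS dA Ξ) (n : ℕ) (h : M.Hist n) : ℝ :=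
  ∑ i : Finset.Iic n, M.c i (h i)

lemma measurable_accCost (M : SOC dS dA Ξ) (n : ℕ) : Measurable (M.accCost n) := by
  unfold accCost
  exact Finset.measurable_sum _ fun i _ =>
    (M.continuous_c i).measurable.comp (measurable_pi_apply i)

/-- A randomized Markov policy of the augmented problem: the augmented state at stage `t` is
`(s, x) ∈ S t × ℝ`, with `x` the cost accumulated before stage `t`, and `kernel t (s, x)` is the law
of the action taken there. -/
structure MarkovPolicy (M : SOC dS dA Ξ) where
  kernel : ∀ t, Kernel (M.S t × ℝ) (M.A t)
  isMarkov : ∀ t, IsMarkovKernel (kernel t)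

instance (M : SOC dS dA Ξ) (π : M.MarkovPolicy) (t : ℕ) : IsMarkovKernel (π.kernel t) :=
  π.isMarkov t

variable [∀ t, MeasurableSpace (Ξ t)]

lemma measurable_F [∀ t, OpensMeasurableSpace (Ξ t)] (M : SOC dS dA Ξ) (t : ℕ) :
    Measurable (M.F t) :=
  measurable_uncurry_of_continuous_of_measurable (u := fun p ξ => M.F t (p, ξ))
    (fun ξ => (M.continuous_F t).comp (Continuous.prodMk_left ξ))
    (fun p => ((M.continuous_F t).comp (Continuous.prodMk_right p)).measurable)

/-- The law of `S_{n+1} = F_n(S_n, A_n, ξ_n)` given the history up to stage `n`, where `ξ_n` has law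
`P n` and is independent of that history. -/
noncomputable def stateKernel (M : SOC dS dA Ξ) (P : ∀ t, Measure (Ξ t)) (n : ℕ) :
    Kernel (M.Hist n) (M.S (n + 1)) :=
  ((Kernel.deterministic (fun h : M.Hist n => h ⟨n, Finset.mem_Iic.2 le_rfl⟩)
      (measurable_pi_apply _)) ×ₖ Kernel.const (M.Hist n) (P n)).map (M.F n)

/-- The law of `(S_{n+1}, A_{n+1})` given the history up to stage `n`: the state follows
`stateKernel`, and then `A_{n+1} ∼ π_{n+1}(· | S_{n+1}, X_{n+1})` with
`X_{n+1} = ∑_{i ≤ n} c_i(S_i, A_i)`. -/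
noncomputable def stepKernel (M : SOC dS dA Ξ) (P : ∀ t, Measure (Ξ t)) (π : M.MarkovPolicy)
    (n : ℕ) : Kernel (M.Hist n) (M.S (n + 1) × M.A (n + 1)) :=
  M.stateKernel P n ⊗ₖ
    (π.kernel (n + 1)).comap (fun p : M.Hist n × M.S (n + 1) => (p.2, M.accCost n p.1))
      (measurable_snd.prodMk ((M.measurable_accCost n).comp measurable_fst))

/-- The law of the history `(S_0, A_0)` with `S_0 = s`, `X_0 = 0` and `A_0 ∼ π_0(· | s, 0)`. -/
noncomputable def initLaw (M : SOC dS dA Ξ) (π : M.MarkovPolicy) (s : M.S 0) :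
    Measure (M.Hist 0) :=
  ((Measure.dirac s).prod (π.kernel 0 (s, 0))).map
    (MeasurableEquiv.piUnique (fun i : Finset.Iic 0 => M.S i × M.A i)).symm

/-- The law of the data process `(S_t, A_t)_{0 ≤ t ≤ T}` started at `S_0 = s`, under the policy `π`
and with independent noises `ξ_t ∼ P t`. -/
noncomputable def pathLaw (M : SOC dS dA Ξ) (P : ∀ t, Measure (Ξ t)) (π : M.MarkovPolicy)
    (T : ℕ) (s : M.S 0) : Measure (M.Hist T) :=
  (M.initLaw π s).bind
    (Kernel.partialTraj (X := fun t => M.S t × M.A t) (M.stepKernel P π) 0 T)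

/-- The risk `R^π(s) = inf_{θ ∈ Θ} E[f_θ(∑_{t ≤ T} c_t(S_t, A_t))]` under the noise laws `P`. -/
noncomputable def risk {d : ℕ} (M : SOC dS dA Ξ) (P : ∀ t, Measure (Ξ t)) (π : M.MarkovPolicy)
    (T : ℕ) (Θ : Set (EuclideanSpace ℝ (Fin d))) (f : EuclideanSpace ℝ (Fin d) → ℝ → ℝ)
    (s : M.S 0) : ℝ :=
  ⨅ θ : Θ, ∫ h, f θ (M.accCost T h) ∂(M.pathLaw P π T s)

end SOC

/-- The empirical distribution of `n` samples. -/
noncomputable def empiricalMeasure {α : Type*} [MeasurableSpace α] {n : ℕ} (x : Fin n → α) :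
    Measure α :=
  (n : ℝ≥0∞)⁻¹ • ∑ i, Measure.dirac (x i)

/-- The distance `‖μ - ν‖₁`, the total mass of the variation `|μ - ν|` of the signed measure
`μ - ν` (so its maximum over pairs of probability measures is `2`). -/
noncomputable def l1Dist {α : Type*} [MeasurableSpace α] (μ ν : Measure α) [IsFiniteMeasure μ]
    [IsFiniteMeasure ν] : ℝ :=
  (μ.toSignedMeasure - ν.toSignedMeasure).totalVariation.real Set.univ

namespace SOC

variable {dS dA : ℕ} {Ξ : ℕ → Type*} [∀ t, TopologicalSpace (Ξ t)]

/-- The standing assumptions on the problem of horizon `T`: state and action spaces are compact of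
radius `R`, costs lie in `[0, 1]`, and `c t`, `F t` are `L`-Lipschitz in `(s, a)` for the Euclidean
distance, uniformly in the noise. -/
structure Regular (M : SOC dS dA Ξ) (T : ℕ) (R L : ℝ) : Prop where
  isCompact_S : ∀ t ≤ T, IsCompact (M.S t)
  isCompact_A : ∀ t ≤ T, IsCompact (M.A t)
  radius_S : ∀ t ≤ T, ∃ z, M.S t ⊆ Metric.closedBall z R
  radius_A : ∀ t ≤ T, ∃ z, M.A t ⊆ Metric.closedBall z R
  cost_mem : ∀ t ≤ T, ∀ p, M.c t p ∈ Set.Icc (0 : ℝ) 1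
  lipschitz_c : ∀ t ≤ T, ∀ (s s' : M.S t) (a a' : M.A t),
    |M.c t (s, a) - M.c t (s', a')| ≤ L * √(dist s s' ^ 2 + dist a a' ^ 2)
  lipschitz_F : ∀ t < T, ∀ (s s' : M.S t) (a a' : M.A t) (ξ : Ξ t),
    dist (M.F t ((s, a), ξ)) (M.F t ((s', a'), ξ)) ≤ L * √(dist s s' ^ 2 + dist a a' ^ 2)

/-- `‖π_t(· | s, x) - π_t(· | s', x')‖₁ ≤ Lπ ‖(s, x) - (s', x')‖` at all stages `t ≤ T`. -/
def MarkovPolicy.IsLipschitz {M : SOC dS dA Ξ} (π : M.MarkovPolicy) (T : ℕ) (Lπ : ℝ) : Prop :=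
  ∀ t ≤ T, ∀ (s s' : M.S t) (x x' : ℝ),
    l1Dist (π.kernel t (s, x)) (π.kernel t (s', x')) ≤ Lπ * √(dist s s' ^ 2 + (x - x') ^ 2)

end SOC

/-! The risk is an infimum over `θ` of expected terminal rewards, so it suffices to compare these
expectations under the true and the empirical noise laws, uniformly in `θ` and `s`. Conditioning
stage by stage (`integral_pathLaw`) turns each expectation into a value function defined by backward
recursion.

Replace the noise laws one stage at a time. The value function of the true laws satisfies the
recursion under the empirical laws up to a one-step error: its integral against `P t` minus its
integral against the empirical measure. Since these errors are propagated by probability kernels,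
they add up to at most `T` times the largest one (`abs_stateValue_sub_le_of_noise`). The integrand
is always the true value function, which does not depend on the samples, so Hoeffding's inequality
applies at each fixed state, action, accumulated cost and `θ`.

Uniformity comes from a finite net. A Lipschitz policy makes the value functions Lipschitz, with a
constant growing by the factor `growth L L_π` per stage (`abs_actionValue_sub_le`), and a union
bound over the net gives `measureReal_exists_transition_deviation_le`. A further union bound over
stages needs no independence between them.

The rewards may be shifted and clipped to be bounded by `L_C * (T + 1)`. The rate `T ^ 5` is then `T
^ 2` from this bound, `T ^ 2` from the tolerance `ε / T` per stage, and `T` from the logarithm of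
the Lipschitz constant (`failure_probability_le`). -/

section Generic

/-! ### Integral estimates, the total mass distance and Hoeffding's inequality. -/

variable {α : Type*} [MeasurableSpace α]

lemma integrable_of_abs_le {μ : Measure α} [IsFiniteMeasure μ] {φ : α → ℝ} (hφ : Measurable φ)
    {B : ℝ} (hB : ∀ a, |φ a| ≤ B) : Integrable φ μ :=
  Integrable.of_bound hφ.aestronglyMeasurable B (ae_of_all _ hB)

lemma abs_integral_le_of_abs_le {μ : Measure α} [IsProbabilityMeasure μ] {φ : α → ℝ}
    {B : ℝ} (hB : ∀ a, |φ a| ≤ B) : |∫ a, φ a ∂μ| ≤ B := by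
  simpa using norm_integral_le_of_norm_le_const (μ := μ) (f := φ) (ae_of_all _ hB)

lemma abs_integral_sub_le_of_abs_sub_le {μ : Measure α} [IsProbabilityMeasure μ] {φ ψ : α → ℝ}
    (hφ : Integrable φ μ) (hψ : Integrable ψ μ) {B : ℝ} (hB : ∀ a, |φ a - ψ a| ≤ B) :
    |∫ a, φ a ∂μ - ∫ a, ψ a ∂μ| ≤ B := by
  rw [← integral_sub hφ hψ]
  exact abs_integral_le_of_abs_le hB

/-- Integrate against the Jordan decomposition of the signed measure `μ - ν`; the masses of its two
parts sum to `l1Dist μ ν`. -/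
lemma abs_integral_sub_integral_le_l1Dist (μ ν : Measure α) [IsFiniteMeasure μ]
    [IsFiniteMeasure ν] {φ : α → ℝ} (hφ : Measurable φ) {B : ℝ} (hB : ∀ a, |φ a| ≤ B) :
    |∫ a, φ a ∂μ - ∫ a, φ a ∂ν| ≤ B * l1Dist μ ν := by
  set j := (μ.toSignedMeasure - ν.toSignedMeasure).toJordanDecomposition with hj
  have h1 : j.posPart.toSignedMeasure - j.negPart.toSignedMeasure
      = μ.toSignedMeasure - ν.toSignedMeasure :=
    SignedMeasure.toSignedMeasure_toJordanDecomposition _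
  -- Moving the negative terms across gives an identity of positive measures, to which additivity of
  -- the integral applies.
  have h2 : μ + j.negPart = ν + j.posPart := by
    rw [← Measure.toSignedMeasure_eq_toSignedMeasure_iff, Measure.toSignedMeasure_add,
      Measure.toSignedMeasure_add]
    rw [sub_eq_sub_iff_add_eq_add] at h1
    rw [add_comm ν.toSignedMeasure, h1]
  have hi (κ : Measure α) [IsFiniteMeasure κ] : Integrable φ κ := integrable_of_abs_le hφ hB
  have h3 : ∫ a, φ a ∂μ + ∫ a, φ a ∂j.negPart = ∫ a, φ a ∂ν + ∫ a, φ a ∂j.posPart := by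
    rw [← integral_add_measure (hi _) (hi _), ← integral_add_measure (hi _) (hi _), h2]
  have hb (κ : Measure α) [IsFiniteMeasure κ] : |∫ a, φ a ∂κ| ≤ B * κ.real Set.univ :=
    norm_integral_le_of_norm_le_const (f := φ) (ae_of_all _ hB)
  have h4 : l1Dist μ ν = j.posPart.real Set.univ + j.negPart.real Set.univ := by
    rw [l1Dist, SignedMeasure.totalVariation, measureReal_add_apply]
  have hp := abs_le.1 (hb j.posPart)
  have hn := abs_le.1 (hb j.negPart)
  rw [h4, abs_le]
  constructor <;> linarith [hp.1, hp.2, hn.1, hn.2]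

instance isProbabilityMeasure_empiricalMeasure {n : ℕ} [NeZero n] (x : Fin n → α) :
    IsProbabilityMeasure (empiricalMeasure x) where
  measure_univ := by
    simp [empiricalMeasure, ENNReal.inv_mul_cancel, NeZero.ne n]

lemma integral_empiricalMeasure {n : ℕ} (x : Fin n → α) {φ : α → ℝ} (hφ : Measurable φ) :
    ∫ a, φ a ∂(empiricalMeasure x) = (n : ℝ)⁻¹ * ∑ i, φ (x i) := by
  rw [empiricalMeasure, integral_smul_measure, integral_finsetSum_measure]
  · simp [integral_dirac' _ _ hφ.stronglyMeasurable]
  · intro i _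
    refine (integrable_dirac' hφ.stronglyMeasurable ?_)
    simp

/-- Hoeffding's inequality: a variable with values in `[-B, B]`, once centred, is sub-Gaussian with
parameter `B ^ 2`. The factor 2 comes from the two tails, treated by `φ` and `-φ`. -/
lemma measureReal_abs_empirical_sub_gt_le {Ω : Type*} [MeasurableSpace Ω] {μ : Measure Ω}
    [IsProbabilityMeasure μ] {P : Measure α} {n : ℕ} (hn : 0 < n) {ξ : Fin n → Ω → α}
    (hlaw : ∀ i, HasLaw (ξ i) P μ) (hind : iIndepFun ξ μ) {φ : α → ℝ} (hφ : Measurable φ)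
    {B : ℝ} (hB0 : 0 < B) (hB : ∀ a, |φ a| ≤ B) {η : ℝ} (hη : 0 ≤ η) :
    μ.real {ω | η < |∫ a, φ a ∂P - ∫ a, φ a ∂(empiricalMeasure fun i => ξ i ω)|}
      ≤ 2 * Real.exp (-(n * η ^ 2 / (2 * B ^ 2))) := by
  have hn' : (0 : ℝ) < n := Nat.cast_pos.2 hn
  have key (ψ : α → ℝ) (hψ : Measurable ψ) (hψB : ∀ a, |ψ a| ≤ B) :
      μ.real {ω | n * η ≤ ∑ i, (ψ (ξ i ω) - ∫ a, ψ a ∂P)}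
        ≤ Real.exp (-(n * η ^ 2 / (2 * B ^ 2))) := by
    have hsub (i : Fin n) : HasSubgaussianMGF (fun ω => ψ (ξ i ω) - ∫ a, ψ a ∂P)
        ((‖B - -B‖₊ / 2) ^ 2) μ := by
      have h := hasSubgaussianMGF_of_mem_Icc (μ := μ) (X := fun ω => ψ (ξ i ω)) (a := -B) (b := B)
        (hψ.comp_aemeasurable (hlaw i).aemeasurable)
        (ae_of_all _ fun ω => abs_le.1 (hψB _))
      have he : ∫ ω, ψ (ξ i ω) ∂μ = ∫ a, ψ a ∂P := by
        rw [← (hlaw i).map_eq, integral_map (hlaw i).aemeasurable hψ.aestronglyMeasurable]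
      rwa [he] at h
    have hind' : iIndepFun (fun i ω => ψ (ξ i ω) - ∫ a, ψ a ∂P) μ :=
      hind.comp (fun _ a => ψ a - ∫ a, ψ a ∂P) fun _ => hψ.sub_const _
    refine (HasSubgaussianMGF.measure_sum_ge_le_of_iIndepFun hind' (s := Finset.univ)
      (fun i _ => hsub i) (mul_nonneg hn'.le hη)).trans (le_of_eq ?_)
    congr 1
    have : ‖B - -B‖ = 2 * B := by
      rw [Real.norm_eq_abs, abs_of_pos] <;> linarith
    simp only [Finset.sum_const, Finset.card_univ, Fintype.card_fin, NNReal.coe_nsmul,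
      NNReal.coe_pow, NNReal.coe_div, coe_nnnorm, this]
    simp
    field_simp
  have hsubset : {ω | η < |∫ a, φ a ∂P - ∫ a, φ a ∂(empiricalMeasure fun i => ξ i ω)|} ⊆
      {ω | n * η ≤ ∑ i, (φ (ξ i ω) - ∫ a, φ a ∂P)} ∪
        {ω | n * η ≤ ∑ i, (-φ (ξ i ω) - ∫ a, -φ a ∂P)} := by
    intro ω hω
    simp only [Set.mem_ofPred_eq] at hω
    rw [integral_empiricalMeasure _ hφ] at hω
    simp only [Set.mem_union, Set.mem_ofPred_eq, Finset.sum_sub_distrib, Finset.sum_const,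
      Finset.card_univ, Fintype.card_fin, nsmul_eq_mul, integral_neg, Finset.sum_neg_distrib]
    rw [← mul_lt_mul_iff_right₀ hn'] at hω
    rcases abs_cases (∫ a, φ a ∂P - (n : ℝ)⁻¹ * ∑ i, φ (ξ i ω)) with ⟨h, _⟩ | ⟨h, _⟩ <;>
      rw [h] at hω
    · right
      rw [mul_sub, mul_inv_cancel_left₀ hn'.ne'] at hω
      linarith
    · left
      rw [neg_sub, mul_sub, mul_inv_cancel_left₀ hn'.ne'] at hω
      linarith
  calc _ ≤ _ := measureReal_mono hsubset
    _ ≤ _ := measureReal_union_le _ _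
    _ ≤ _ := by
      have := key φ hφ hB
      have := key (fun a => -φ a) hφ.neg (by simpa using hB)
      linarith

end Generic

/-! ### Packing and covering numbers in finite dimension. -/

section Covering

variable {E : Type*} [NormedAddCommGroup E] [NormedSpace ℝ E] [FiniteDimensional ℝ E]

open Metric Module in
-- Volume comparison: the balls of radius `ρ / 2` around the points are disjoint and lie in a ball
-- of radius `r + ρ / 2`.
lemma card_le_of_pairwise_le_dist {z : E} {r ρ : ℝ} (hr : 0 ≤ r) (hρ : 0 < ρ) (s : Finset E)
    (hs : (s : Set E) ⊆ closedBall z r) (h : (s : Set E).Pairwise fun x y => ρ ≤ dist x y) :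
    (s.card : ℝ) ≤ (1 + 2 * r / ρ) ^ finrank ℝ E := by
  borelize E
  let μ : Measure E := Measure.addHaar
  have hρ2 : 0 < ρ / 2 := by positivity
  have hR : 0 < r + ρ / 2 := by positivity
  have hdisj : (s : Set E).PairwiseDisjoint fun c => ball c (ρ / 2) := by
    intro c hc d hd hcd
    exact ball_disjoint_ball (by linarith [h hc hd hcd])
  have hsub : (⋃ c ∈ s, ball c (ρ / 2)) ⊆ ball z (r + ρ / 2) :=
    Set.iUnion₂_subset fun x hx => ball_subset_ball' (by
      have := mem_closedBall.1 (hs hx); linarith)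
  have hI : (s.card : ℝ≥0∞) * ENNReal.ofReal ((ρ / 2) ^ finrank ℝ E) * μ (ball 0 1) ≤
      ENNReal.ofReal ((r + ρ / 2) ^ finrank ℝ E) * μ (ball 0 1) :=
    calc
      _ = μ (⋃ c ∈ s, ball c (ρ / 2)) := by
        rw [measure_biUnion_finset hdisj fun c _ => measurableSet_ball]
        simp only [μ.addHaar_ball_of_pos _ hρ2, Finset.sum_const, nsmul_eq_mul, mul_assoc]
      _ ≤ μ (ball z (r + ρ / 2)) := measure_mono hsub
      _ = _ := by simp only [μ.addHaar_ball_of_pos _ hR]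
  have hJ := (ENNReal.mul_le_mul_iff_left (measure_ball_pos _ _ zero_lt_one).ne'
    measure_ball_lt_top.ne).1 hI
  have hK := ENNReal.toReal_le_of_le_ofReal (pow_nonneg hR.le _) hJ
  rw [ENNReal.toReal_mul, ENNReal.toReal_natCast,
    ENNReal.toReal_ofReal (pow_nonneg hρ2.le _), ← le_div_iff₀ (pow_pos hρ2 _), ← div_pow] at hK
  refine hK.trans_eq ?_
  congr 1
  field_simp
  ring

open Metric Module in
-- A `ρ`-separated subset of largest cardinality is a net, since a point far from it could be added.
-- Its points lie in `Z` itself, which matters because the functions evaluated there are only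
-- defined on `Z`.
lemma exists_finset_cover_card_le {z : E} {r ρ : ℝ} (hr : 0 ≤ r) (hρ : 0 < ρ) {Z : Set E}
    (hZ : Z ⊆ closedBall z r) :
    ∃ s : Finset E, (s : Set E) ⊆ Z ∧ (∀ x ∈ Z, ∃ y ∈ s, dist x y ≤ ρ) ∧
      (s.card : ℝ) ≤ (1 + 2 * r / ρ) ^ finrank ℝ E := by
  classical
  let K : Set ℕ := {k | ∃ s : Finset E, (s : Set E) ⊆ Z ∧
    (s : Set E).Pairwise (fun x y => ρ ≤ dist x y) ∧ s.card = k}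
  have hne : K.Nonempty := ⟨0, ∅, by simp⟩
  have hbdd : BddAbove K := by
    refine ⟨⌈(1 + 2 * r / ρ) ^ finrank ℝ E⌉₊, ?_⟩
    rintro _ ⟨s, hs, hsep, rfl⟩
    exact_mod_cast (card_le_of_pairwise_le_dist hr hρ s (hs.trans hZ) hsep).trans (Nat.le_ceil _)
  obtain ⟨s, hs, hsep, hcard⟩ := Nat.sSup_mem hne hbdd
  refine ⟨s, hs, fun x hx => ?_, card_le_of_pairwise_le_dist hr hρ s (hs.trans hZ) hsep⟩
  by_contra! hfar
  have hxs : x ∉ s := fun hxs => by simpa [hρ.not_gt] using hfar x hxs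
  have hmem : s.card + 1 ∈ K := by
    refine ⟨insert x s, ?_, ?_, Finset.card_insert_of_notMem hxs⟩
    · rw [Finset.coe_insert]
      exact Set.insert_subset hx hs
    · rw [Finset.coe_insert]
      refine hsep.insert fun y hy _ => ⟨(hfar y hy).le, ?_⟩
      rw [dist_comm]
      exact (hfar y hy).le
  have := le_csSup hbdd hmem
  omega

end Covering

/-! ### Value functions by backward recursion. -/

namespace SOC

variable {dS dA : ℕ} {Ξ : ℕ → Type*} [∀ t, TopologicalSpace (Ξ t)] [∀ t, MeasurableSpace (Ξ t)]

/-- The expected terminal reward `g(∑ c)` when `m` stages follow stage `t`, at which the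
state-action pair is `p` and the cost accumulated so far is `x`. -/
noncomputable def actionValue (M : SOC dS dA Ξ) (P : ∀ t, Measure (Ξ t)) (π : M.MarkovPolicy)
    (g : ℝ → ℝ) : ℕ → ∀ t, M.S t × M.A t → ℝ → ℝ
  | 0, t, p, x => g (x + M.c t p)
  | m + 1, t, p, x => ∫ ξ, ∫ a, actionValue M P π g m (t + 1) (M.F t (p, ξ), a) (x + M.c t p)
      ∂(π.kernel (t + 1) (M.F t (p, ξ), x + M.c t p)) ∂(P t)

/-- The expected terminal reward `g(∑ c)` when `m` stages follow stage `t`, at which the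
augmented state is `(s, x)`. -/
noncomputable def stateValue (M : SOC dS dA Ξ) (P : ∀ t, Measure (Ξ t)) (π : M.MarkovPolicy)
    (g : ℝ → ℝ) (m t : ℕ) (s : M.S t) (x : ℝ) : ℝ :=
  ∫ a, M.actionValue P π g m t (s, a) x ∂(π.kernel t (s, x))

section

variable (M : SOC dS dA Ξ) (P : ∀ t, Measure (Ξ t)) (π : M.MarkovPolicy) (g : ℝ → ℝ)

lemma actionValue_zero (t : ℕ) (p : M.S t × M.A t) (x : ℝ) :
    M.actionValue P π g 0 t p x = g (x + M.c t p) := rfl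

lemma actionValue_succ (m t : ℕ) (p : M.S t × M.A t) (x : ℝ) :
    M.actionValue P π g (m + 1) t p x =
      ∫ ξ, M.stateValue P π g m (t + 1) (M.F t (p, ξ)) (x + M.c t p) ∂(P t) := rfl

end

variable {M : SOC dS dA Ξ} {P P' : ∀ t, Measure (Ξ t)} [∀ t, IsProbabilityMeasure (P t)]
  [∀ t, IsProbabilityMeasure (P' t)] {π : M.MarkovPolicy} {g g' : ℝ → ℝ} {B : ℝ}

lemma abs_actionValue_le (hB : ∀ z, |g z| ≤ B) (m t : ℕ) (p : M.S t × M.A t) (x : ℝ) :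
    |M.actionValue P π g m t p x| ≤ B := by
  induction m generalizing t x with
  | zero => exact hB _
  | succ m ih =>
    exact abs_integral_le_of_abs_le fun ξ => abs_integral_le_of_abs_le fun a => ih _ _ _

lemma abs_stateValue_le (hB : ∀ z, |g z| ≤ B) (m t : ℕ) (s : M.S t) (x : ℝ) :
    |M.stateValue P π g m t s x| ≤ B :=
  abs_integral_le_of_abs_le fun _ => abs_actionValue_le hB _ _ _ _

/-- The constant that majorizes the growth factor of the Lipschitz constants in one stage. -/
noncomputable def growth (L L_π : ℝ) : ℝ := 4 * max 1 L * max 1 L_π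

lemma four_le_growth (L L_π : ℝ) : 4 ≤ growth L L_π := by
  have h1 := le_max_left 1 L
  have h2 := le_max_left 1 L_π
  unfold growth
  nlinarith

/-- The product metric is a maximum, so each of the three distances is at most the product distance;
hence the constant `3 * K`. -/
lemma continuous_of_abs_sub_le {X Y : Type*} [PseudoMetricSpace X] [PseudoMetricSpace Y]
    {φ : (X × Y) × ℝ → ℝ} {K : ℝ} (hK : 0 ≤ K)
    (h : ∀ s s' a a' x x', |φ ((s, a), x) - φ ((s', a'), x')| ≤
      K * (dist s s' + dist a a' + |x - x'|)) : Continuous φ := by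
  refine (LipschitzWith.of_dist_le_mul (K := (3 * K).toNNReal) ?_).continuous
  rintro ⟨⟨s, a⟩, x⟩ ⟨⟨s', a'⟩, x'⟩
  rw [Real.coe_toNNReal _ (by positivity), Real.dist_eq]
  refine (h s s' a a' x x').trans ?_
  have h1 : dist s s' ≤ dist ((s, a), x) ((s', a'), x') :=
    le_max_of_le_left (le_max_left _ _)
  have h2 : dist a a' ≤ dist ((s, a), x) ((s', a'), x') :=
    le_max_of_le_left (le_max_right _ _)
  have h3 : |x - x'| ≤ dist ((s, a), x) ((s', a'), x') := by
    rw [← Real.dist_eq]; exact le_max_right _ _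
  nlinarith

lemma sqrt_sq_add_sq_le_add {a b : ℝ} (ha : 0 ≤ a) (hb : 0 ≤ b) : √(a ^ 2 + b ^ 2) ≤ a + b :=
  Real.sqrt_le_iff.2 ⟨add_nonneg ha hb, by nlinarith [mul_nonneg ha hb]⟩

/-! ### Lipschitz bounds and perturbation of the value functions. -/

section Lipschitz

variable {T : ℕ} {R L L_π : ℝ}

omit [∀ t, MeasurableSpace (Ξ t)] in
lemma Regular.abs_cost_sub_le (hM : M.Regular T R L) {t : ℕ} (ht : t ≤ T)
    (s s' : M.S t) (a a' : M.A t) :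
    |M.c t (s, a) - M.c t (s', a')| ≤ max 1 L * (dist s s' + dist a a') :=
  (hM.lipschitz_c t ht s s' a a').trans (mul_le_mul (le_max_right _ _)
    (sqrt_sq_add_sq_le_add dist_nonneg dist_nonneg) (by positivity) (by positivity))

omit [∀ t, MeasurableSpace (Ξ t)] in
lemma Regular.dist_transition_le (hM : M.Regular T R L) {t : ℕ} (ht : t < T)
    (s s' : M.S t) (a a' : M.A t) (ξ : Ξ t) :
    dist (M.F t ((s, a), ξ)) (M.F t ((s', a'), ξ)) ≤ max 1 L * (dist s s' + dist a a') :=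
  (hM.lipschitz_F t ht s s' a a' ξ).trans (mul_le_mul (le_max_right _ _)
    (sqrt_sq_add_sq_le_add dist_nonneg dist_nonneg) (by positivity) (by positivity))

/-- Move the integrand with the action law fixed, at cost `K`; then move the action law with the
integrand fixed, at cost `B * L_π`. -/
lemma abs_stateValue_sub_le_of_actionValue (hπ : π.IsLipschitz T L_π) (hLπ : 0 ≤ L_π)
    (hB0 : 0 ≤ B) (hB : ∀ z, |g z| ≤ B) {K : ℝ} (hK : 0 ≤ K) {m t : ℕ} (ht : t ≤ T)
    (h : ∀ (s s' : M.S t) (a a' : M.A t) (x x' : ℝ),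
      |M.actionValue P π g m t (s, a) x - M.actionValue P π g m t (s', a') x'|
        ≤ K * (dist s s' + dist a a' + |x - x'|)) (s s' : M.S t) (x x' : ℝ) :
    |M.stateValue P π g m t s x - M.stateValue P π g m t s' x'|
      ≤ (K + B * L_π) * (dist s s' + |x - x'|) := by
  have hc : Continuous fun q : (M.S t × M.A t) × ℝ => M.actionValue P π g m t q.1 q.2 :=
    continuous_of_abs_sub_le hK h
  have hm (s : M.S t) (x : ℝ) : Measurable fun a => M.actionValue P π g m t (s, a) x :=
    (hc.comp (f := fun a => ((s, a), x)) (by fun_prop)).measurable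
  have hi (s : M.S t) (x : ℝ) (κ : Measure (M.A t)) [IsFiniteMeasure κ] :
      Integrable (fun a => M.actionValue P π g m t (s, a) x) κ :=
    integrable_of_abs_le (hm s x) fun a => abs_actionValue_le hB _ _ _ _
  have h1 : |M.stateValue P π g m t s x - ∫ a, M.actionValue P π g m t (s', a) x'
      ∂(π.kernel t (s, x))| ≤ K * (dist s s' + |x - x'|) :=
    abs_integral_sub_le_of_abs_sub_le (hi _ _ _) (hi _ _ _) fun a => by
      simpa using h s s' a a x x'
  have h2 : |∫ a, M.actionValue P π g m t (s', a) x' ∂(π.kernel t (s, x))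
      - M.stateValue P π g m t s' x'| ≤ B * (L_π * (dist s s' + |x - x'|)) := by
    refine (abs_integral_sub_integral_le_l1Dist _ _ (hm s' x')
      fun a => abs_actionValue_le hB _ _ _ _).trans (mul_le_mul_of_nonneg_left ?_ hB0)
    refine (hπ t ht s s' x x').trans (mul_le_mul_of_nonneg_left ?_ hLπ)
    rw [← sq_abs (x - x')]
    exact sqrt_sq_add_sq_le_add dist_nonneg (abs_nonneg _)
  refine (abs_sub_le _ _ _).trans ((add_le_add h1 h2).trans (le_of_eq ?_))
  ring

variable [∀ t, OpensMeasurableSpace (Ξ t)]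

omit [∀ t, IsProbabilityMeasure (P t)] in
lemma measurable_stateValue_transition {m t : ℕ}
    {K : ℝ} (hK : 0 ≤ K) (h : ∀ (s s' : M.S (t + 1)) (x x' : ℝ),
      |M.stateValue P π g m (t + 1) s x - M.stateValue P π g m (t + 1) s' x'|
      ≤ K * (dist s s' + |x - x'|)) (p : M.S t × M.A t) (x : ℝ) :
    Measurable fun ξ => M.stateValue P π g m (t + 1) (M.F t (p, ξ)) x := by
  have hc : Continuous fun s => M.stateValue P π g m (t + 1) s x :=
    (LipschitzWith.of_dist_le_mul (K := K.toNNReal) fun s s' => by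
      simpa [Real.coe_toNNReal _ hK, Real.dist_eq] using h s s' x x).continuous
  exact hc.measurable.comp ((M.continuous_F t).comp (Continuous.prodMk_right p)).measurable

omit [∀ t, MeasurableSpace (Ξ t)] [∀ t, OpensMeasurableSpace (Ξ t)] in
lemma Regular.abs_add_cost_sub_le (hM : M.Regular T R L) {t : ℕ} (ht : t ≤ T)
    (s s' : M.S t) (a a' : M.A t) (x x' : ℝ) :
    |(x + M.c t (s, a)) - (x' + M.c t (s', a'))|
      ≤ |x - x'| + max 1 L * (dist s s' + dist a a') := by
  rw [add_sub_add_comm]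
  exact (abs_add_le _ _).trans (by gcongr; exact hM.abs_cost_sub_le ht s s' a a')

omit [∀ t, OpensMeasurableSpace (Ξ t)] in
-- As the power of `growth L L_π` is at least 1, the additive term `B * L_π` is absorbed into the
-- factor `2 * max 1 L_π`.
lemma abs_stateValue_sub_le_of_growth (hπ : π.IsLipschitz T L_π)
    (hLπ : 0 ≤ L_π) (hB0 : 0 ≤ B) (hB : ∀ z, |g z| ≤ B) {m t : ℕ} (ht : t ≤ T)
    (h : ∀ (s s' : M.S t) (a a' : M.A t) (x x' : ℝ),
      |M.actionValue P π g m t (s, a) x - M.actionValue P π g m t (s', a') x'|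
        ≤ B * growth L L_π ^ (m + 1) * (dist s s' + dist a a' + |x - x'|))
    (s s' : M.S t) (x x' : ℝ) :
    |M.stateValue P π g m t s x - M.stateValue P π g m t s' x'|
      ≤ B * growth L L_π ^ (m + 1) * (2 * max 1 L_π) * (dist s s' + |x - x'|) := by
  have hG := four_le_growth L L_π
  refine (abs_stateValue_sub_le_of_actionValue hπ hLπ hB0 hB (by positivity) ht h s s' x
    x').trans ?_
  gcongr
  have h0 : 1 ≤ growth L L_π ^ (m + 1) := one_le_pow₀ (by linarith)
  rw [mul_assoc, ← mul_add]
  refine mul_le_mul_of_nonneg_left ?_ hB0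
  nlinarith [le_max_left 1 L_π, le_max_right 1 L_π]

omit [∀ t, OpensMeasurableSpace (Ξ t)] in
-- The next state and the accumulated cost together contribute `2 * max 1 L`; multiplied by the
-- policy factor `2 * max 1 L_π`, this is exactly `growth L L_π`.
lemma abs_stateValue_transition_sub_le_of_growth (hM : M.Regular T R L) (hπ : π.IsLipschitz T L_π)
    (hLπ : 0 ≤ L_π) (hB0 : 0 ≤ B) (hB : ∀ z, |g z| ≤ B) {m t : ℕ} (ht : t + 1 ≤ T)
    (h : ∀ (s s' : M.S (t + 1)) (a a' : M.A (t + 1)) (x x' : ℝ),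
      |M.actionValue P π g m (t + 1) (s, a) x - M.actionValue P π g m (t + 1) (s', a') x'|
        ≤ B * growth L L_π ^ (m + 1) * (dist s s' + dist a a' + |x - x'|))
    (s s' : M.S t) (a a' : M.A t) (x x' : ℝ) (ξ : Ξ t) :
    |M.stateValue P π g m (t + 1) (M.F t ((s, a), ξ)) (x + M.c t (s, a))
      - M.stateValue P π g m (t + 1) (M.F t ((s', a'), ξ)) (x' + M.c t (s', a'))|
      ≤ B * growth L L_π ^ (m + 2) * (dist s s' + dist a a' + |x - x'|) := by
  have hG := four_le_growth L L_π
  have hL1 : 1 ≤ max 1 L := le_max_left _ _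
  calc _ ≤ B * growth L L_π ^ (m + 1) * (2 * max 1 L_π) * _ :=
        abs_stateValue_sub_le_of_growth hπ hLπ hB0 hB ht h _ _ _ _
    _ ≤ B * growth L L_π ^ (m + 1) * (2 * max 1 L_π) *
        (2 * max 1 L * (dist s s' + dist a a' + |x - x'|)) := by
      gcongr
      have h1 := hM.abs_add_cost_sub_le (by omega) s s' a a' x x'
      have h2 := hM.dist_transition_le (by omega) s s' a a' ξ
      nlinarith [abs_nonneg (x - x')]
    _ = _ := by
      rw [pow_succ _ (m + 1), show growth L L_π = 4 * max 1 L * max 1 L_π from rfl]; ring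

lemma abs_actionValue_sub_le (hM : M.Regular T R L) (hπ : π.IsLipschitz T L_π)
    (hLπ : 0 ≤ L_π) (hB0 : 0 ≤ B) (hB : ∀ z, |g z| ≤ B)
    (hg : ∀ z z', |g z - g z'| ≤ B * |z - z'|) (m : ℕ) :
    ∀ t, t + m = T → ∀ (s s' : M.S t) (a a' : M.A t) (x x' : ℝ),
      |M.actionValue P π g m t (s, a) x - M.actionValue P π g m t (s', a') x'|
        ≤ B * growth L L_π ^ (m + 1) * (dist s s' + dist a a' + |x - x'|) := by
  have hG := four_le_growth L L_π
  induction m with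
  | zero =>
    intro t ht s s' a a' x x'
    rw [actionValue_zero, actionValue_zero]
    have h1 : max 1 L ≤ growth L L_π := by
      have hL1 : 1 ≤ max 1 L := le_max_left _ _
      have hLπ1 : 1 ≤ max 1 L_π := le_max_left _ _
      unfold growth
      nlinarith
    have h2 := mul_le_mul_of_nonneg_right h1 (add_nonneg (dist_nonneg (x := s) (y := s'))
      (dist_nonneg (x := a) (y := a')))
    calc _ ≤ B * _ := hg _ _
      _ ≤ B * (growth L L_π * (dist s s' + dist a a' + |x - x'|)) := by
        gcongr
        have := hM.abs_add_cost_sub_le (by omega) s s' a a' x x'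
        nlinarith [abs_nonneg (x - x')]
      _ = _ := by ring
  | succ m ih =>
    intro t ht s s' a a' x x'
    have hK : 0 ≤ B * growth L L_π ^ (m + 1) * (2 * max 1 L_π) := by positivity
    have hV := abs_stateValue_sub_le_of_growth hπ hLπ hB0 hB (by omega) (ih (t + 1) (by omega))
    rw [actionValue_succ, actionValue_succ]
    refine abs_integral_sub_le_of_abs_sub_le ?_ ?_
      (abs_stateValue_transition_sub_le_of_growth hM hπ hLπ hB0 hB (by omega)
        (ih (t + 1) (by omega)) s s' a a' x x')
    all_goals
      exact integrable_of_abs_le (measurable_stateValue_transition hK hV _ _)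
        fun _ => abs_stateValue_le hB _ _ _ _

lemma abs_stateValue_sub_le (hM : M.Regular T R L) (hπ : π.IsLipschitz T L_π)
    (hLπ : 0 ≤ L_π) (hB0 : 0 ≤ B) (hB : ∀ z, |g z| ≤ B)
    (hg : ∀ z z', |g z - g z'| ≤ B * |z - z'|) {m t : ℕ} (ht : t + m = T)
    (s s' : M.S t) (x x' : ℝ) :
    |M.stateValue P π g m t s x - M.stateValue P π g m t s' x'|
      ≤ B * growth L L_π ^ (m + 1) * (2 * max 1 L_π) * (dist s s' + |x - x'|) :=
  abs_stateValue_sub_le_of_growth hπ hLπ hB0 hB (by omega)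
    (abs_actionValue_sub_le hM hπ hLπ hB0 hB hg m t ht) s s' x x'

lemma abs_stateValue_transition_sub_le (hM : M.Regular T R L) (hπ : π.IsLipschitz T L_π)
    (hLπ : 0 ≤ L_π) (hB0 : 0 ≤ B) (hB : ∀ z, |g z| ≤ B)
    (hg : ∀ z z', |g z - g z'| ≤ B * |z - z'|) {m t : ℕ} (ht : t + 1 + m = T)
    (s s' : M.S t) (a a' : M.A t) (x x' : ℝ) (ξ : Ξ t) :
    |M.stateValue P π g m (t + 1) (M.F t ((s, a), ξ)) (x + M.c t (s, a))
      - M.stateValue P π g m (t + 1) (M.F t ((s', a'), ξ)) (x' + M.c t (s', a'))|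
      ≤ B * growth L L_π ^ (m + 2) * (dist s s' + dist a a' + |x - x'|) :=
  abs_stateValue_transition_sub_le_of_growth hM hπ hLπ hB0 hB (by omega)
    (abs_actionValue_sub_le hM hπ hLπ hB0 hB hg m (t + 1) ht) s s' a a' x x' ξ

lemma measurable_stateValue_comp (hM : M.Regular T R L) (hπ : π.IsLipschitz T L_π)
    (hLπ : 0 ≤ L_π) (hB0 : 0 ≤ B) (hB : ∀ z, |g z| ≤ B)
    (hg : ∀ z z', |g z - g z'| ≤ B * |z - z'|) {m t : ℕ} (ht : t + 1 + m = T)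
    (p : M.S t × M.A t) (x : ℝ) :
    Measurable fun ξ => M.stateValue P π g m (t + 1) (M.F t (p, ξ)) x := by
  have hG := four_le_growth L L_π
  exact measurable_stateValue_transition (by positivity)
    (abs_stateValue_sub_le hM hπ hLπ hB0 hB hg ht) p x

lemma continuous_actionValue (hM : M.Regular T R L) (hπ : π.IsLipschitz T L_π)
    (hLπ : 0 ≤ L_π) (hB0 : 0 ≤ B) (hB : ∀ z, |g z| ≤ B)
    (hg : ∀ z z', |g z - g z'| ≤ B * |z - z'|) {m t : ℕ} (ht : t + m = T) :
    Continuous fun q : (M.S t × M.A t) × ℝ => M.actionValue P π g m t q.1 q.2 := by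
  have hG := four_le_growth L L_π
  exact continuous_of_abs_sub_le (by positivity)
    (abs_actionValue_sub_le hM hπ hLπ hB0 hB hg m t ht)

lemma integrable_actionValue (hM : M.Regular T R L) (hπ : π.IsLipschitz T L_π)
    (hLπ : 0 ≤ L_π) (hB0 : 0 ≤ B) (hB : ∀ z, |g z| ≤ B)
    (hg : ∀ z z', |g z - g z'| ≤ B * |z - z'|) {m t : ℕ} (ht : t + m = T)
    (s : M.S t) (x : ℝ) (κ : Measure (M.A t)) [IsFiniteMeasure κ] :
    Integrable (fun a => M.actionValue P π g m t (s, a) x) κ :=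
  integrable_of_abs_le ((continuous_actionValue hM hπ hLπ hB0 hB hg ht).comp
    (f := fun a => ((s, a), x)) (by fun_prop)).measurable fun _ => abs_actionValue_le hB _ _ _ _

/-- The values at two reward functions that are uniformly `Δ`-close are `Δ`-close. -/
lemma abs_actionValue_sub_le_of_reward (hM : M.Regular T R L) (hπ : π.IsLipschitz T L_π)
    (hLπ : 0 ≤ L_π) (hB0 : 0 ≤ B) (hB : ∀ z, |g z| ≤ B)
    (hg : ∀ z z', |g z - g z'| ≤ B * |z - z'|) (hB' : ∀ z, |g' z| ≤ B)
    (hg' : ∀ z z', |g' z - g' z'| ≤ B * |z - z'|) {Δ : ℝ} (hΔ : ∀ z, |g z - g' z| ≤ Δ) (m : ℕ) :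
    ∀ t, t + m = T → ∀ (p : M.S t × M.A t) (x : ℝ),
      |M.actionValue P π g m t p x - M.actionValue P π g' m t p x| ≤ Δ := by
  induction m with
  | zero => exact fun t _ p x => hΔ _
  | succ m ih =>
    intro t ht p x
    refine abs_integral_sub_le_of_abs_sub_le
      (integrable_of_abs_le (measurable_stateValue_comp hM hπ hLπ hB0 hB hg (by omega) _ _)
        fun _ => abs_stateValue_le hB _ _ _ _)
      (integrable_of_abs_le (measurable_stateValue_comp hM hπ hLπ hB0 hB' hg' (by omega) _ _)
        fun _ => abs_stateValue_le hB' _ _ _ _) fun ξ => ?_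
    exact abs_integral_sub_le_of_abs_sub_le
      (integrable_actionValue hM hπ hLπ hB0 hB hg (by omega) _ _ _)
      (integrable_actionValue hM hπ hLπ hB0 hB' hg' (by omega) _ _ _)
      fun a => ih (t + 1) (by omega) _ _

lemma abs_stateValue_sub_le_of_reward (hM : M.Regular T R L) (hπ : π.IsLipschitz T L_π)
    (hLπ : 0 ≤ L_π) (hB0 : 0 ≤ B) (hB : ∀ z, |g z| ≤ B)
    (hg : ∀ z z', |g z - g z'| ≤ B * |z - z'|) (hB' : ∀ z, |g' z| ≤ B)
    (hg' : ∀ z z', |g' z - g' z'| ≤ B * |z - z'|) {Δ : ℝ} (hΔ : ∀ z, |g z - g' z| ≤ Δ) {m t : ℕ}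
    (ht : t + m = T) (s : M.S t) (x : ℝ) :
    |M.stateValue P π g m t s x - M.stateValue P π g' m t s x| ≤ Δ :=
  abs_integral_sub_le_of_abs_sub_le
    (integrable_actionValue hM hπ hLπ hB0 hB hg ht _ _ _)
    (integrable_actionValue hM hπ hLπ hB0 hB' hg' ht _ _ _)
    fun a => abs_actionValue_sub_le_of_reward hM hπ hLπ hB0 hB hg hB' hg' hΔ m t ht (s, a) x

/-- One-step errors of the noise laws add up along the stages. -/
lemma abs_actionValue_sub_le_of_noise (hM : M.Regular T R L) (hπ : π.IsLipschitz T L_π)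
    (hLπ : 0 ≤ L_π) (hB0 : 0 ≤ B) (hB : ∀ z, |g z| ≤ B)
    (hg : ∀ z z', |g z - g z'| ≤ B * |z - z'|) {η : ℝ}
    (h : ∀ t m, t + 1 + m = T → ∀ (p : M.S t × M.A t), ∀ x ∈ Set.Icc (0 : ℝ) t,
      |∫ ξ, M.stateValue P π g m (t + 1) (M.F t (p, ξ)) (x + M.c t p) ∂(P t)
        - ∫ ξ, M.stateValue P π g m (t + 1) (M.F t (p, ξ)) (x + M.c t p) ∂(P' t)| ≤ η) (m : ℕ) :
    ∀ t, t + m = T → ∀ (p : M.S t × M.A t), ∀ x ∈ Set.Icc (0 : ℝ) t,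
      |M.actionValue P π g m t p x - M.actionValue P' π g m t p x| ≤ m * η := by
  induction m with
  | zero => intro t _ p x _; simp [actionValue_zero]
  | succ m ih =>
    intro t ht p x hx
    have hc := hM.cost_mem t (by omega) p
    -- Accumulated costs reached from `[0, t]` stay in `[0, t + 1]`, so one-step errors are needed
    -- only on a bounded set.
    have hx' : x + M.c t p ∈ Set.Icc (0 : ℝ) (t + 1 : ℕ) := by
      push_cast
      exact ⟨add_nonneg hx.1 hc.1, add_le_add hx.2 hc.2⟩
    rw [actionValue_succ, actionValue_succ]
    -- The intermediate term integrates the value function of `P` against `P' t`: the hypothesis on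
    -- one-step errors controls the change of law, the induction hypothesis the change of value
    -- function.
    refine (abs_sub_le _ _ _).trans ((add_le_add (h t m (by omega) p x hx)
      (abs_integral_sub_le_of_abs_sub_le (B := m * η)
      (integrable_of_abs_le (measurable_stateValue_comp hM hπ hLπ hB0 hB hg (by omega) _ _)
        fun _ => abs_stateValue_le hB _ _ _ _)
      (integrable_of_abs_le (measurable_stateValue_comp hM hπ hLπ hB0 hB hg (by omega) _ _)
        fun _ => abs_stateValue_le hB _ _ _ _) fun ξ => ?_)).trans (le_of_eq ?_))
    · exact abs_integral_sub_le_of_abs_sub_le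
        (integrable_actionValue hM hπ hLπ hB0 hB hg (by omega) _ _ _)
        (integrable_actionValue hM hπ hLπ hB0 hB hg (by omega) _ _ _)
        fun a => ih (t + 1) (by omega) _ _ hx'
    · push_cast; ring

lemma abs_stateValue_sub_le_of_noise (hM : M.Regular T R L) (hπ : π.IsLipschitz T L_π)
    (hLπ : 0 ≤ L_π) (hB0 : 0 ≤ B) (hB : ∀ z, |g z| ≤ B)
    (hg : ∀ z z', |g z - g z'| ≤ B * |z - z'|) {η : ℝ}
    (h : ∀ t m, t + 1 + m = T → ∀ (p : M.S t × M.A t), ∀ x ∈ Set.Icc (0 : ℝ) t,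
      |∫ ξ, M.stateValue P π g m (t + 1) (M.F t (p, ξ)) (x + M.c t p) ∂(P t)
        - ∫ ξ, M.stateValue P π g m (t + 1) (M.F t (p, ξ)) (x + M.c t p) ∂(P' t)| ≤ η)
    (s : M.S 0) :
    |M.stateValue P π g T 0 s 0 - M.stateValue P' π g T 0 s 0| ≤ T * η :=
  abs_integral_sub_le_of_abs_sub_le
    (integrable_actionValue hM hπ hLπ hB0 hB hg (zero_add T) _ _ _)
    (integrable_actionValue hM hπ hLπ hB0 hB hg (zero_add T) _ _ _)
    fun a => abs_actionValue_sub_le_of_noise hM hπ hLπ hB0 hB hg h T 0 (zero_add T) (s, a) 0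
      (by simp)

end Lipschitz

end SOC

/-! ### Disintegration of the path law and its identification with the recursion. -/

lemma integral_bind_kernel {α β : Type*} [MeasurableSpace α] [MeasurableSpace β] {μ : Measure α}
    [SFinite μ] {κ : Kernel α β} [IsSFiniteKernel κ] {φ : β → ℝ} (hφ : Integrable φ (μ.bind κ)) :
    ∫ y, φ y ∂(μ.bind κ) = ∫ x, ∫ y, φ y ∂(κ x) ∂μ := by
  have h : μ.bind κ = (κ ∘ₖ Kernel.const Unit μ) () := by
    rw [Kernel.comp_apply, Kernel.const_apply]
  rw [h] at hφ ⊢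
  rw [Kernel.integral_comp hφ, Kernel.const_apply]

lemma integral_partialTraj_succ_self {X : ℕ → Type*} [∀ n, MeasurableSpace (X n)]
    {κ : ∀ n, Kernel (∀ i : Finset.Iic n, X i) (X (n + 1))} [∀ n, IsMarkovKernel (κ n)] (n : ℕ)
    (h : ∀ i : Finset.Iic n, X i) {φ : (∀ i : Finset.Iic (n + 1), X i) → ℝ} (hφ : Measurable φ) :
    ∫ H, φ H ∂(Kernel.partialTraj κ n (n + 1) h) =
      ∫ y, φ (IicProdIoc n (n + 1) (h, MeasurableEquiv.piSingleton (X := X) n y)) ∂(κ n h) := by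
  have hm : Measurable fun y => φ (IicProdIoc n (n + 1) (h, y)) :=
    (hφ.comp measurable_IicProdIoc).comp measurable_prodMk_left
  have := Kernel.IsMarkovKernel.map (κ n) (MeasurableEquiv.piSingleton (X := X) n).measurable
  rw [Kernel.partialTraj_succ_self, Kernel.map_apply _ measurable_IicProdIoc,
    integral_map measurable_IicProdIoc.aemeasurable hφ.aestronglyMeasurable,
    Kernel.prod_apply, Kernel.id_apply, Measure.dirac_prod,
    Kernel.map_apply _ (MeasurableEquiv.measurable _)]
  exact (integral_map measurable_prodMk_left.aemeasurable
      (hφ.comp measurable_IicProdIoc).aestronglyMeasurable).trans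
    (integral_map (MeasurableEquiv.measurable _).aemeasurable hm.aestronglyMeasurable)

namespace SOC

variable {dS dA : ℕ} {Ξ : ℕ → Type*} [∀ t, TopologicalSpace (Ξ t)] [∀ t, MeasurableSpace (Ξ t)]
  [∀ t, OpensMeasurableSpace (Ξ t)]

variable {M : SOC dS dA Ξ} {P : ∀ t, Measure (Ξ t)} [∀ t, IsProbabilityMeasure (P t)]
  {π : M.MarkovPolicy} {g : ℝ → ℝ} {B : ℝ}

instance (n : ℕ) : IsMarkovKernel (M.stateKernel P n) :=
  Kernel.IsMarkovKernel.map _ (M.measurable_F n)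

instance (n : ℕ) : IsMarkovKernel (M.stepKernel P π n) := by
  unfold stepKernel
  infer_instance

instance (s : M.S 0) : IsProbabilityMeasure (M.initLaw π s) :=
  Measure.isProbabilityMeasure_map (MeasurableEquiv.measurable _).aemeasurable

instance (T : ℕ) (s : M.S 0) : IsProbabilityMeasure (M.pathLaw P π T s) := by
  unfold pathLaw
  infer_instance

omit [∀ t, MeasurableSpace (Ξ t)] [∀ t, OpensMeasurableSpace (Ξ t)] in
lemma accCost_succ (n : ℕ) (H : M.Hist (n + 1)) :
    M.accCost (n + 1) H = M.accCost n (Preorder.frestrictLe₂ (π := fun t => M.S t × M.A t) n.le_succ H)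
      + M.c (n + 1) (H ⟨n + 1, Finset.mem_Iic.2 le_rfl⟩) := by
  -- Extending the costs to all of `ℕ` allows sums over `Finset.Iic`; the default value 0 is never
  -- summed.
  let φ : ℕ → ℝ := fun i => if hi : i ∈ Finset.Iic (n + 1) then M.c i (H ⟨i, hi⟩) else 0
  have h1 : M.accCost (n + 1) H = ∑ i ∈ Finset.Iic (n + 1), φ i := by
    rw [← Finset.sum_coe_sort]
    exact Finset.sum_congr rfl fun i _ => by simp only [φ, dif_pos i.2]
  have h2 : M.accCost n (Preorder.frestrictLe₂ (π := fun t => M.S t × M.A t) n.le_succ H) = ∑ i ∈ Finset.Iic n, φ i := by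
    rw [← Finset.sum_coe_sort]
    refine Finset.sum_congr rfl fun i _ => ?_
    have hi : (i : ℕ) ∈ Finset.Iic (n + 1) :=
      Finset.mem_Iic.2 ((Finset.mem_Iic.1 i.2).trans n.le_succ)
    simp only [φ, dif_pos hi]
    rfl
  have h3 : M.c (n + 1) (H ⟨n + 1, Finset.mem_Iic.2 le_rfl⟩) = φ (n + 1) := by
    simp only [φ, Finset.mem_Iic, le_refl, dite_true]
  rw [h1, h2, h3, ← Nat.range_succ_eq_Iic, ← Nat.range_succ_eq_Iic, Finset.sum_range_succ]

omit [∀ t, MeasurableSpace (Ξ t)] [∀ t, OpensMeasurableSpace (Ξ t)] in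
lemma accCost_zero (h : M.Hist 0) :
    M.accCost 0 h = M.c 0 (h ⟨0, Finset.mem_Iic.2 le_rfl⟩) := by
  unfold accCost
  exact Fintype.sum_unique (fun i : Finset.Iic 0 => M.c i (h i))

omit [∀ t, MeasurableSpace (Ξ t)] [∀ t, OpensMeasurableSpace (Ξ t)] in
lemma Regular.accCost_mem {T : ℕ} {R L : ℝ} (hM : M.Regular T R L) (h : M.Hist T) :
    M.accCost T h ∈ Set.Icc (0 : ℝ) (T + 1) := by
  have hc (i : Finset.Iic T) := hM.cost_mem i (Finset.mem_Iic.1 i.2) (h i)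
  refine ⟨Finset.sum_nonneg fun i _ => (hc i).1, ?_⟩
  refine (Finset.sum_le_card_nsmul _ _ 1 fun i _ => (hc i).2).trans ?_
  simp

lemma integral_pathLaw_succ (n : ℕ) (s : M.S 0) {φ : M.Hist (n + 1) → ℝ} (hφ : Measurable φ)
    (hB : ∀ H, |φ H| ≤ B) :
    ∫ H, φ H ∂(M.pathLaw P π (n + 1) s) = ∫ h, ∫ y, φ (IicProdIoc (X := fun t => M.S t × M.A t) n (n + 1)
      (h, MeasurableEquiv.piSingleton (X := fun t => M.S t × M.A t) n y)) ∂(M.stepKernel P π n h)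
      ∂(M.pathLaw P π n s) := by
  have h1 : M.pathLaw P π (n + 1) s = (M.pathLaw P π n s).bind
      (Kernel.partialTraj (X := fun t => M.S t × M.A t) (M.stepKernel P π) n (n + 1)) := by
    rw [pathLaw, Kernel.partialTraj_succ_eq_comp (Nat.zero_le n), ← Measure.comp_assoc]
    rfl
  rw [h1, integral_bind_kernel (integrable_of_abs_le hφ hB)]
  congr 1 with h
  exact integral_partialTraj_succ_self (X := fun t => M.S t × M.A t) n h hφ

omit [∀ t, MeasurableSpace (Ξ t)] [∀ t, OpensMeasurableSpace (Ξ t)] in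
lemma integral_initLaw (s : M.S 0) {φ : M.Hist 0 → ℝ} (hφ : Measurable φ) :
    ∫ h, φ h ∂(M.initLaw π s) = ∫ a, φ ((MeasurableEquiv.piUnique
      (fun i : Finset.Iic 0 => M.S i × M.A i)).symm (s, a)) ∂(π.kernel 0 (s, 0)) := by
  refine (integral_map_equiv (MeasurableEquiv.piUnique
    (fun i : Finset.Iic 0 => M.S i × M.A i)).symm φ).trans ?_
  have h1 : Measurable fun y => φ ((MeasurableEquiv.piUnique
    (fun i : Finset.Iic 0 => M.S i × M.A i)).symm y) := hφ.comp (MeasurableEquiv.measurable _)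
  refine (congrArg (fun ν => ∫ y, φ ((MeasurableEquiv.piUnique
    (fun i : Finset.Iic 0 => M.S i × M.A i)).symm y) ∂ν) (Measure.dirac_prod
    (ν := π.kernel 0 (s, 0)) s)).trans ?_
  exact integral_map measurable_prodMk_left.aemeasurable h1.aestronglyMeasurable

/-- The conditional expectation of the terminal reward given a history, when `m` stages follow. -/
noncomputable def histValue (M : SOC dS dA Ξ) (P : ∀ t, Measure (Ξ t)) (π : M.MarkovPolicy)
    (g : ℝ → ℝ) (m n : ℕ) (h : M.Hist n) : ℝ :=
  M.actionValue P π g m n (h ⟨n, Finset.mem_Iic.2 le_rfl⟩)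
    -- `accCost` already counts stage `n`, while `actionValue` adds that cost itself.
    (M.accCost n h - M.c n (h ⟨n, Finset.mem_Iic.2 le_rfl⟩))

section

variable {T : ℕ} {R L L_π : ℝ}

lemma measurable_histValue (hM : M.Regular T R L) (hπ : π.IsLipschitz T L_π)
    (hLπ : 0 ≤ L_π) (hB0 : 0 ≤ B) (hB : ∀ z, |g z| ≤ B)
    (hg : ∀ z z', |g z - g z'| ≤ B * |z - z'|) {m n : ℕ} (hn : n + m = T) :
    Measurable (M.histValue P π g m n) := by
  have h1 : Measurable fun h : M.Hist n => h ⟨n, Finset.mem_Iic.2 le_rfl⟩ := measurable_pi_apply _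
  exact (continuous_actionValue hM hπ hLπ hB0 hB hg hn).measurable.comp
    (h1.prodMk ((M.measurable_accCost n).sub ((M.continuous_c n).measurable.comp h1)))

/-- The tower property: integrating out the last state-action pair by `stepKernel` is one step of
the backward recursion. -/
lemma integral_histValue_succ (hM : M.Regular T R L) (hπ : π.IsLipschitz T L_π)
    (hLπ : 0 ≤ L_π) (hB0 : 0 ≤ B) (hB : ∀ z, |g z| ≤ B)
    (hg : ∀ z z', |g z - g z'| ≤ B * |z - z'|) {m n : ℕ} (hn : n + 1 + m = T) (s : M.S 0) :
    ∫ H, M.histValue P π g m (n + 1) H ∂(M.pathLaw P π (n + 1) s)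
      = ∫ h, M.histValue P π g (m + 1) n h ∂(M.pathLaw P π n s) := by
  rw [integral_pathLaw_succ n s (measurable_histValue hM hπ hLπ hB0 hB hg hn)
    fun H => abs_actionValue_le hB _ _ _ _]
  congr 1 with h
  have h1 (y : M.S (n + 1) × M.A (n + 1)) : M.histValue P π g m (n + 1) (IicProdIoc (X := fun t => M.S t × M.A t) n (n + 1)
      (h, MeasurableEquiv.piSingleton (X := fun t => M.S t × M.A t) n y))
      = M.actionValue P π g m (n + 1) y (M.accCost n h) := by
    set H := IicProdIoc (X := fun t => M.S t × M.A t) n (n + 1)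
      (h, MeasurableEquiv.piSingleton (X := fun t => M.S t × M.A t) n y) with hH
    have hy : H ⟨n + 1, Finset.mem_Iic.2 le_rfl⟩ = y := by
      simp [hH, IicProdIoc, MeasurableEquiv.piSingleton]
    have hh : Preorder.frestrictLe₂ (π := fun t => M.S t × M.A t) n.le_succ H = h :=
      congrFun (frestrictLe₂_comp_IicProdIoc (X := fun t => M.S t × M.A t) n.le_succ)
        (h, MeasurableEquiv.piSingleton (X := fun t => M.S t × M.A t) n y)
    rw [histValue, accCost_succ, add_sub_cancel_right, hy, hh]
  simp_rw [h1]
  have hc : Continuous fun y => M.actionValue P π g m (n + 1) y (M.accCost n h) :=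
    (continuous_actionValue hM hπ hLπ hB0 hB hg hn).comp
      (f := fun y => (y, M.accCost n h)) (by fun_prop)
  have hV : Measurable fun s' => M.stateValue P π g m (n + 1) s' (M.accCost n h) :=
    (LipschitzWith.of_dist_le_mul (K := (B * growth L L_π ^ (m + 1) * (2 * max 1 L_π)).toNNReal) fun s s' => by
      have hG := four_le_growth L L_π
      simpa [Real.coe_toNNReal _ (show 0 ≤ B * growth L L_π ^ (m + 1) * (2 * max 1 L_π) by
        positivity), Real.dist_eq] using abs_stateValue_sub_le hM hπ hLπ hB0 hB hg hn s s' (M.accCost n h)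
          (M.accCost n h)).continuous.measurable
  rw [histValue, actionValue_succ, sub_add_cancel, stepKernel,
    ProbabilityTheory.integral_compProd (integrable_of_abs_le hc.measurable
      fun y => abs_actionValue_le hB _ _ _ _)]
  change ∫ s', M.stateValue P π g m (n + 1) s' (M.accCost n h) ∂(M.stateKernel P n h) = _
  rw [stateKernel, Kernel.map_apply _ (M.measurable_F n),
    integral_map (M.measurable_F n).aemeasurable hV.aestronglyMeasurable, Kernel.prod_apply,
    Kernel.deterministic_apply, Kernel.const_apply, Measure.dirac_prod]
  exact integral_map measurable_prodMk_left.aemeasurable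
      (hV.comp (M.measurable_F n)).aestronglyMeasurable

lemma integral_histValue_zero (hM : M.Regular T R L) (hπ : π.IsLipschitz T L_π)
    (hLπ : 0 ≤ L_π) (hB0 : 0 ≤ B) (hB : ∀ z, |g z| ≤ B)
    (hg : ∀ z z', |g z - g z'| ≤ B * |z - z'|) (s : M.S 0) :
    ∫ h, M.histValue P π g T 0 h ∂(M.pathLaw P π 0 s) = M.stateValue P π g T 0 s 0 := by
  have hm := measurable_histValue (P := P) hM hπ hLπ hB0 hB hg (zero_add T)
  have h0 : M.pathLaw P π 0 s = M.initLaw π s := by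
    rw [pathLaw, Kernel.partialTraj_self, Measure.id_comp]
  rw [h0, integral_initLaw s hm]
  simp only [histValue, accCost_zero, sub_self]
  rfl

/-- The mean of `histValue` at stage `n`, with `T - n` stages to follow, does not depend on `n`; the
two sides are its values at `n = T` and `n = 0`. -/
theorem integral_pathLaw (hM : M.Regular T R L) (hπ : π.IsLipschitz T L_π)
    (hLπ : 0 ≤ L_π) (hB0 : 0 ≤ B) (hB : ∀ z, |g z| ≤ B)
    (hg : ∀ z z', |g z - g z'| ≤ B * |z - z'|) (s : M.S 0) :
    ∫ h, g (M.accCost T h) ∂(M.pathLaw P π T s) = M.stateValue P π g T 0 s 0 := by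
  have key (n : ℕ) : ∀ m, n + m = T →
      ∫ h, M.histValue P π g m n h ∂(M.pathLaw P π n s) = M.stateValue P π g T 0 s 0 := by
    induction n with
    | zero =>
      intro m hm
      obtain rfl : m = T := by omega
      exact integral_histValue_zero hM hπ hLπ hB0 hB hg s
    | succ n ih =>
      intro m hm
      rw [integral_histValue_succ hM hπ hLπ hB0 hB hg hm, ih (m + 1) (by omega)]
  rw [← key T 0 (add_zero T)]
  simp only [histValue, actionValue_zero, sub_add_cancel]

end

end SOC

/-! ### Uniform deviation over a Lipschitz family. -/

section UniformDeviation

variable {α : Type*} [MeasurableSpace α] {E : Type*} [NormedAddCommGroup E] [NormedSpace ℝ E]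
  [FiniteDimensional ℝ E]

/-- Passing to the nearest net point moves each of the two integrals by at most `K * ρ`, together at
most `η`. A deviation above `2 * η` anywhere thus forces one above `η` at a net point. -/
lemma measureReal_exists_abs_empirical_sub_gt_le {Ω : Type*} [MeasurableSpace Ω] {μ : Measure Ω}
    [IsProbabilityMeasure μ] {P : Measure α} [IsProbabilityMeasure P] {n : ℕ} [NeZero n]
    {ξ : Fin n → Ω → α} (hlaw : ∀ i, HasLaw (ξ i) P μ) (hind : iIndepFun ξ μ) {Z : Set E} {z : E}
    {r : ℝ} (hr : 0 ≤ r) (hZ : Z ⊆ Metric.closedBall z r) {φ : Z → α → ℝ}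
    (hφ : ∀ z, Measurable (φ z)) {B : ℝ} (hB0 : 0 < B) (hB : ∀ z a, |φ z a| ≤ B) {K : ℝ}
    (hK : 0 ≤ K) (hlip : ∀ z z' a, |φ z a - φ z' a| ≤ K * dist z z') {η ρ : ℝ} (hη : 0 ≤ η)
    (hρ : 0 < ρ) (hKρ : 2 * K * ρ ≤ η) :
    μ.real {ω | ∃ z, 2 * η < |∫ a, φ z a ∂P - ∫ a, φ z a ∂(empiricalMeasure fun i => ξ i ω)|}
      ≤ (1 + 2 * r / ρ) ^ Module.finrank ℝ E * (2 * Real.exp (-(n * η ^ 2 / (2 * B ^ 2)))) := by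
  obtain ⟨s, hsZ, hcov, hcard⟩ := exists_finset_cover_card_le hr hρ hZ
  have hsub : {ω | ∃ z, 2 * η < |∫ a, φ z a ∂P - ∫ a, φ z a ∂(empiricalMeasure fun i => ξ i ω)|} ⊆
      ⋃ y ∈ s.attach, {ω | η < |∫ a, φ ⟨y, hsZ y.2⟩ a ∂P
        - ∫ a, φ ⟨y, hsZ y.2⟩ a ∂(empiricalMeasure fun i => ξ i ω)|} := by
    rintro ω ⟨⟨x, hx⟩, hω⟩
    obtain ⟨y, hy, hxy⟩ := hcov x hx
    simp only [Finset.mem_attach, Set.iUnion_true, Set.mem_iUnion, Set.mem_ofPred_eq]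
    refine ⟨⟨y, hy⟩, ?_⟩
    have hclose (κ : Measure α) [IsProbabilityMeasure κ] :
        |∫ a, φ ⟨x, hx⟩ a ∂κ - ∫ a, φ ⟨y, hsZ hy⟩ a ∂κ| ≤ K * ρ :=
      abs_integral_sub_le_of_abs_sub_le (integrable_of_abs_le (hφ _) (hB _))
        (integrable_of_abs_le (hφ _) (hB _)) fun a =>
          (hlip _ _ a).trans (mul_le_mul_of_nonneg_left hxy hK)
    have h1 := abs_le.1 (hclose P)
    have h2 := abs_le.1 (hclose (empiricalMeasure fun i => ξ i ω))
    by_contra! hle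
    have h3 := abs_le.1 hle
    exact hω.not_ge (abs_le.2 ⟨by linarith, by linarith⟩)
  refine (measureReal_mono hsub (measure_ne_top _ _)).trans
    ((measureReal_biUnion_finset_le _ _).trans ?_)
  refine (Finset.sum_le_sum fun (y : s) _ => measureReal_abs_empirical_sub_gt_le
    (Nat.pos_of_ne_zero (NeZero.ne n)) hlaw hind (hφ ⟨y, hsZ y.2⟩) hB0 (hB _) hη).trans ?_
  rw [Finset.sum_const, Finset.card_attach, nsmul_eq_mul]
  gcongr

end UniformDeviation

/-! ### Clipping of the reward, and comparison of infima. -/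

section Clipping

/-- The function `φ - φ 0` restricted to `[0, b]` and extended by constants. -/
noncomputable def clipped (φ : ℝ → ℝ) (b z : ℝ) : ℝ := φ (max 0 (min z b)) - φ 0

lemma clipped_of_mem {φ : ℝ → ℝ} {b z : ℝ} (hz : z ∈ Set.Icc 0 b) :
    clipped φ b z = φ z - φ 0 := by
  rw [clipped, min_eq_left hz.2, max_eq_right hz.1]

lemma abs_clipped_le {φ : ℝ → ℝ} {K b : ℝ} (hb : 0 ≤ b) (hK : 0 ≤ K)
    (hφ : ∀ z z', |φ z - φ z'| ≤ K * |z - z'|) (z : ℝ) : |clipped φ b z| ≤ K * b := by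
  refine (hφ _ _).trans (mul_le_mul_of_nonneg_left ?_ hK)
  rw [sub_zero, abs_of_nonneg (le_max_left _ _)]
  exact max_le hb (min_le_right _ _)

lemma abs_clipped_sub_le {φ : ℝ → ℝ} {K b : ℝ} (hK : 0 ≤ K)
    (hφ : ∀ z z', |φ z - φ z'| ≤ K * |z - z'|) (z z' : ℝ) :
    |clipped φ b z - clipped φ b z'| ≤ K * |z - z'| := by
  rw [clipped, clipped, sub_sub_sub_cancel_right]
  refine (hφ _ _).trans (mul_le_mul_of_nonneg_left ?_ hK)
  have h1 := abs_max_sub_max_le_max 0 (min z b) 0 (min z' b)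
  have h2 := abs_min_sub_min_le_max z b z' b
  simp only [sub_self, abs_zero] at h1 h2
  rw [max_eq_right (abs_nonneg (min z b - min z' b))] at h1
  rw [max_eq_left (abs_nonneg _)] at h2
  exact h1.trans h2

lemma abs_clipped_sub_clipped_le {φ ψ : ℝ → ℝ} {Δ b : ℝ} (h : ∀ z, |φ z - ψ z| ≤ Δ) (z : ℝ) :
    |clipped φ b z - clipped ψ b z| ≤ 2 * Δ := by
  have h1 := abs_le.1 (h (max 0 (min z b)))
  have h2 := abs_le.1 (h 0)
  unfold clipped
  rw [abs_le]
  constructor <;> linarith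

end Clipping

lemma abs_ciInf_sub_ciInf_le {ι : Type*} [Nonempty ι] {a b : ι → ℝ}
    (ha : BddBelow (Set.range a)) (hb : BddBelow (Set.range b)) {ε : ℝ}
    (h : ∀ i, |a i - b i| ≤ ε) : |(⨅ i, a i) - ⨅ i, b i| ≤ ε := by
  have h1 : (⨅ i, a i) - ε ≤ ⨅ i, b i :=
    le_ciInf fun i => by linarith [ciInf_le ha i, (abs_le.1 (h i)).2]
  have h2 : (⨅ i, b i) - ε ≤ ⨅ i, a i :=
    le_ciInf fun i => by linarith [ciInf_le hb i, (abs_le.1 (h i)).1]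
  rw [abs_le]
  constructor <;> linarith

/-! ### Arithmetic of the sample size. -/

set_option maxHeartbeats 1000000 in
-- Every quantity, including the net size and `1 / δ`, is bounded by a power of the argument `q` of
-- the logarithm, with exponent linear in `T`; the sample size makes the Hoeffding exponential beat
-- that power.
lemma failure_probability_le {T dS dA d n : ℕ} (hT : 0 < T) (hdS : 0 < dS) (hdA : 0 < dA)
    (hd : 0 < d) {L_C L_Θ L L_π R R_Θ ε δ : ℝ} (hLC : 0 ≤ L_C) (hLΘ : 0 ≤ L_Θ) (hε : 0 < ε)
    (hδ : 0 < δ) (hδ1 : δ < 1) (hεL : ε < 2 * (L_C * (T + 1)))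
    (hn : 3200 * (T ^ 5 * L_C ^ 2 * dS * dA * d / ε ^ 2 *
      Real.log (max 2 (T * max 1 L_C * max 1 L_Θ * max 1 L * max 1 L_π * max 1 R * max 1 R_Θ
        / (ε * δ)))) ≤ n) :
    T * ((1 + 2 * (T * max 1 R * max 1 R_Θ) / (ε / (4 * T *
        (3 * (L_C * (T + 1) * SOC.growth L L_π ^ (T + 1)) + 2 * L_Θ)))) ^ (dS + (dA + (1 + d))) *
      (2 * Real.exp (-(n * (ε / (2 * T)) ^ 2 / (2 * (L_C * (T + 1)) ^ 2))))) ≤ δ := by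
  have hG := SOC.four_le_growth L L_π
  have hGe : SOC.growth L L_π = 4 * (max 1 L * max 1 L_π) := by unfold SOC.growth; ring
  generalize SOC.growth L L_π = G at hG hGe ⊢
  have hC1 : 1 ≤ max 1 L_C := le_max_left _ _
  have hCle : L_C ≤ max 1 L_C := le_max_right _ _
  have hΘ1 : 1 ≤ max 1 L_Θ := le_max_left _ _
  have hΘle : L_Θ ≤ max 1 L_Θ := le_max_right _ _
  have hL1 : 1 ≤ max 1 L := le_max_left _ _
  have hπ1 : 1 ≤ max 1 L_π := le_max_left _ _
  have hR1 : 1 ≤ max 1 R := le_max_left _ _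
  have hRΘ1 : 1 ≤ max 1 R_Θ := le_max_left _ _
  generalize max 1 L_C = lC at *
  generalize max 1 L_Θ = lΘ at *
  generalize max 1 L = lL at *
  generalize max 1 L_π = lπ at *
  generalize max 1 R = lR at *
  generalize max 1 R_Θ = lRΘ at *
  have hT1 : (1 : ℝ) ≤ T := by exact_mod_cast hT
  have hLC0 : 0 < L_C := by
    by_contra! h
    have : L_C = 0 := le_antisymm h hLC
    subst this
    linarith
  -- The restriction `ε < 2 * (L_C * (T + 1))` is used here: it keeps this factor away from 0, so
  -- the other factors of the argument are at most `4 * q`.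
  have hA : 1 / 4 ≤ T * lC / ε := by
    rw [le_div_iff₀ hε]
    nlinarith
  have hδinv : 1 ≤ 1 / δ := (one_le_div hδ).2 hδ1.le
  have hQ : T * lC * lΘ * lL * lπ * lR * lRΘ / (ε * δ)
      = (T * lC / ε) * (lΘ * lR * lRΘ) * (lL * lπ) * (1 / δ) := by field_simp
  rw [hQ] at hn
  have hw : 1 ≤ lΘ * lR * lRΘ := one_le_mul_of_one_le_of_one_le
    (one_le_mul_of_one_le_of_one_le hΘ1 hR1) hRΘ1
  have hu : 1 ≤ lL * lπ := one_le_mul_of_one_le_of_one_le hL1 hπ1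
  set q := max 2 ((T * lC / ε) * (lΘ * lR * lRΘ) * (lL * lπ) * (1 / δ)) with hq
  have hq2 : 2 ≤ q := le_max_left _ _
  have hq1 : 1 ≤ q := by linarith
  have hQq : (T * lC / ε) * (lΘ * lR * lRΘ) * (lL * lπ) * (1 / δ) ≤ q := le_max_right _ _
  have hA0 : 0 < T * lC / ε := by linarith
  clear_value q
  have h1 : T * lC / ε * (lΘ * lR * lRΘ) ≤ q := by
    refine le_trans ?_ hQq
    rw [mul_assoc _ (lL * lπ)]
    exact le_mul_of_one_le_right (by positivity) (one_le_mul_of_one_le_of_one_le hu hδinv)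
  have hAw : 1 / 4 ≤ T * lC / ε * (lΘ * lR * lRΘ) :=
    hA.trans (le_mul_of_one_le_right hA0.le hw)
  have hprod : (lL * lπ) * (1 / δ) ≤ 4 * q := by
    have : 1 / 4 * ((lL * lπ) * (1 / δ)) ≤ q := by
      refine le_trans ?_ hQq
      rw [mul_assoc _ (lL * lπ)]
      exact mul_le_mul_of_nonneg_right hAw (by positivity)
    linarith
  have h2 : 1 / δ ≤ 4 * q := (le_mul_of_one_le_left (by positivity) hu).trans hprod
  have h3 : lL * lπ ≤ 4 * q := (le_mul_of_one_le_right (by positivity) hδinv).trans hprod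
  have hq3 : 8 ≤ q ^ 3 := by
    calc (8 : ℝ) = 2 ^ 3 := by norm_num
      _ ≤ q ^ 3 := by gcongr
  have hq4 : 16 ≤ q ^ 4 := by
    calc (16 : ℝ) = 2 ^ 4 := by norm_num
      _ ≤ q ^ 4 := by gcongr
  have hq6 : 64 ≤ q ^ 6 := by
    calc (64 : ℝ) = 2 ^ 6 := by norm_num
      _ ≤ q ^ 6 := by gcongr
  -- A crude bound suffices, because `G ^ (T + 1)` already forces an exponent linear in `T`.
  have hTq : (T : ℝ) ≤ q ^ T := by
    calc (T : ℝ) ≤ 2 ^ T := by exact_mod_cast Nat.lt_two_pow_self.le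
      _ ≤ q ^ T := by gcongr
  have hGq : G ≤ q ^ 5 := by
    calc G ≤ 16 * q := by linarith
      _ ≤ q ^ 4 * q := by gcongr
      _ = q ^ 5 := by ring
  have hG1 : 1 ≤ G ^ (T + 1) := one_le_pow₀ (by linarith)
  have hK : 3 * (L_C * (T + 1) * G ^ (T + 1)) + 2 * L_Θ ≤ 8 * T * lC * lΘ * G ^ (T + 1) := by
    have ha : L_C * (T + 1) * G ^ (T + 1) ≤ 2 * T * lC * lΘ * G ^ (T + 1) := by
      refine mul_le_mul_of_nonneg_right ?_ (by positivity)
      calc L_C * (T + 1) ≤ lC * (2 * T) := by gcongr; linarith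
        _ ≤ lC * (2 * T) * lΘ := le_mul_of_one_le_right (by positivity) hΘ1
        _ = _ := by ring
    have hb : L_Θ ≤ T * lC * lΘ * G ^ (T + 1) := by
      calc L_Θ ≤ lΘ := hΘle
        _ ≤ (T * lC * G ^ (T + 1)) * lΘ := le_mul_of_one_le_left (by linarith)
          (one_le_mul_of_one_le_of_one_le (one_le_mul_of_one_le_of_one_le hT1 hC1) hG1)
        _ = _ := by ring
    linarith
  have hK0 : 0 < 3 * (L_C * (T + 1) * G ^ (T + 1)) + 2 * L_Θ := by positivity
  set K := 3 * (L_C * (T + 1) * G ^ (T + 1)) + 2 * L_Θ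
  clear_value K
  set X := 1 + 2 * (T * lR * lRΘ) / (ε / (4 * T * K)) with hX
  have hX1 : 1 ≤ X := by
    rw [hX]
    exact le_add_of_nonneg_right (by positivity)
  have hXq : X ≤ q ^ (7 * T + 13) := by
    have hy : 1 ≤ q ^ (7 * T + 12) := one_le_pow₀ hq1
    have hle : 2 * (T * lR * lRΘ) / (ε / (4 * T * K)) ≤ q ^ (7 * T + 12) := by
      calc 2 * (T * lR * lRΘ) / (ε / (4 * T * K)) = 8 * T ^ 2 * lR * lRΘ / ε * K := by
            field_simp; ring
        _ ≤ 8 * T ^ 2 * lR * lRΘ / ε * (8 * T * lC * lΘ * G ^ (T + 1)) := by gcongr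
        _ = 64 * T ^ 2 * (T * lC / ε * (lΘ * lR * lRΘ)) * G ^ (T + 1) := by field_simp; ring
        _ ≤ q ^ 6 * (q ^ T) ^ 2 * q * (q ^ 5) ^ (T + 1) := by gcongr
        _ = q ^ (7 * T + 12) := by ring
    calc X ≤ q ^ (7 * T + 12) * 2 := by linarith
      _ ≤ q ^ (7 * T + 12) * q := by gcongr
      _ = q ^ (7 * T + 13) := by ring
  clear_value X
  have hU : 2 * T * (1 / δ) ≤ q ^ (T + 4) := by
    calc 2 * T * (1 / δ) ≤ 2 * q ^ T * (4 * q) := by gcongr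
      _ = 8 * q ^ T * q := by ring
      _ ≤ q ^ 3 * q ^ T * q := by gcongr
      _ = q ^ (T + 4) := by ring
  have hU1 : 1 ≤ 2 * T * (1 / δ) := one_le_mul_of_one_le_of_one_le (by linarith) hδinv
  -- The exponents add up to `8 * T + 17`, at most `25 * T` because `T ≥ 1`.
  have hUX : 2 * T * (1 / δ) * X ≤ q ^ (25 * T) := by
    calc 2 * T * (1 / δ) * X ≤ q ^ (T + 4) * q ^ (7 * T + 13) := by gcongr
      _ = q ^ (8 * T + 17) := by ring
      _ ≤ q ^ (25 * T) := pow_le_pow_right₀ hq1 (by omega)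
  have hlogq : 0 ≤ Real.log q := Real.log_nonneg hq1
  set D := dS + (dA + (1 + d)) with hD
  have hDle : (D : ℝ) ≤ 4 * (dS * dA * d) := by
    have a1 : dS ≤ dS * dA * d := by
      rw [mul_assoc]; exact Nat.le_mul_of_pos_right _ (Nat.mul_pos hdA hd)
    have a2 : dA ≤ dS * dA * d := by
      rw [mul_comm dS, mul_assoc]; exact Nat.le_mul_of_pos_right _ (Nat.mul_pos hdS hd)
    have a3 : d ≤ dS * dA * d := Nat.le_mul_of_pos_left _ (Nat.mul_pos hdS hdA)
    have : D ≤ 4 * (dS * dA * d) := by omega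
    exact_mod_cast this
  have hD0 : D ≠ 0 := by omega
  clear_value D
  -- The constant is `3200 = 25 * 4 * 32`: 4 from `hDle`, and 32 from `ε / (2 * T)` and `L_C * (T +
  -- 1) ≤ 2 * T * L_C` in the Hoeffding exponent.
  have hexp : (25 * T * D : ℝ) * Real.log q
      ≤ n * (ε / (2 * T)) ^ 2 / (2 * (L_C * (T + 1)) ^ 2) := by
    have hB : L_C * (T + 1) ≤ 2 * T * L_C := by nlinarith
    calc (25 * T * D : ℝ) * Real.log q ≤ 25 * T * (4 * (dS * dA * d)) * Real.log q := by gcongr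
      _ = 3200 * (T ^ 5 * L_C ^ 2 * dS * dA * d / ε ^ 2 * Real.log q) * (ε / (2 * T)) ^ 2
          / (2 * (2 * T * L_C) ^ 2) := by field_simp; ring
      _ ≤ n * (ε / (2 * T)) ^ 2 / (2 * (L_C * (T + 1)) ^ 2) := by gcongr
  have hexp' : Real.exp (-(n * (ε / (2 * T)) ^ 2 / (2 * (L_C * (T + 1)) ^ 2)))
      ≤ (q ^ (25 * T * D))⁻¹ := by
    rw [← Real.exp_log (show 0 < (q ^ (25 * T * D))⁻¹ by positivity), Real.exp_le_exp,
      Real.log_inv, Real.log_pow]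
    push_cast
    linarith
  have hmain : 2 * T * (1 / δ) * X ^ D ≤ q ^ (25 * T * D) := by
    calc 2 * T * (1 / δ) * X ^ D ≤ (2 * T * (1 / δ)) ^ D * X ^ D := by
          gcongr
          exact le_self_pow₀ hU1 hD0
      _ = (2 * T * (1 / δ) * X) ^ D := (mul_pow _ _ _).symm
      _ ≤ (q ^ (25 * T)) ^ D := by gcongr
      _ = q ^ (25 * T * D) := by rw [← pow_mul]
  have hq0 : 0 < q ^ (25 * T * D) := by positivity
  have hX0 : 0 ≤ X ^ D := by positivity
  generalize q ^ (25 * T * D) = W at *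
  generalize X ^ D = Y at *
  calc T * (Y * (2 * Real.exp (-(n * (ε / (2 * T)) ^ 2 / (2 * (L_C * (T + 1)) ^ 2)))))
      ≤ T * (Y * (2 * W⁻¹)) := by gcongr
    _ = δ * (2 * T * (1 / δ) * Y) * W⁻¹ := by
      linear_combination (-(2 * T * Y * W⁻¹)) * mul_one_div_cancel hδ.ne'
    _ ≤ δ * W * W⁻¹ := by gcongr
    _ = δ := by rw [mul_assoc, mul_inv_cancel₀ hq0.ne', mul_one]

/-! ### From the risk to one-step deviations. -/

namespace SOC

variable {dS dA d : ℕ} {Ξ : ℕ → Type*} [∀ t, TopologicalSpace (Ξ t)]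
  [∀ t, MeasurableSpace (Ξ t)] [∀ t, OpensMeasurableSpace (Ξ t)]
  {M : SOC dS dA Ξ} {P P' : ∀ t, Measure (Ξ t)} [∀ t, IsProbabilityMeasure (P t)]
  [∀ t, IsProbabilityMeasure (P' t)] {π : M.MarkovPolicy}
  {Θ : Set (EuclideanSpace ℝ (Fin d))} {f : EuclideanSpace ℝ (Fin d) → ℝ → ℝ}
  {T : ℕ} {L_C L_Θ L L_π R R_Θ : ℝ}

/-- Total costs lie in `[0, T + 1]`, where clipping only subtracts `φ 0`. The bound `L_C * (T + 1)`
of the clipped reward also serves as its Lipschitz constant. -/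
lemma integral_pathLaw_eq_add_stateValue {φ : ℝ → ℝ} (hLC : 0 ≤ L_C) (hLπ : 0 ≤ L_π)
    (hφ : ∀ z z', |φ z - φ z'| ≤ L_C * |z - z'|)
    (hM : M.Regular T R L) (hπ : π.IsLipschitz T L_π) (s : M.S 0) :
    ∫ h, φ (M.accCost T h) ∂(M.pathLaw P π T s)
      = φ 0 + M.stateValue P π (clipped φ (T + 1)) T 0 s 0 := by
  have hB := abs_clipped_le (by positivity : (0 : ℝ) ≤ T + 1) hLC hφ
  have hg (z z' : ℝ) : |clipped φ (T + 1) z - clipped φ (T + 1) z'|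
      ≤ L_C * (T + 1) * |z - z'| :=
    (abs_clipped_sub_le hLC hφ z z').trans (mul_le_mul_of_nonneg_right
      (le_mul_of_one_le_right hLC (by simp)) (abs_nonneg _))
  have hB0 : 0 ≤ L_C * (T + 1) := by positivity
  have hcont : Continuous (clipped φ (T + 1)) :=
    (LipschitzWith.of_dist_le_mul (K := (L_C * (T + 1)).toNNReal) fun z z' => by
      simpa only [Real.coe_toNNReal _ hB0, Real.dist_eq] using hg z z').continuous
  have hm : Measurable fun h => clipped φ (T + 1) (M.accCost T h) :=
    hcont.measurable.comp (M.measurable_accCost T)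
  rw [← integral_pathLaw hM hπ hLπ hB0 hB hg s]
  calc _ = ∫ h, (φ 0 + clipped φ (T + 1) (M.accCost T h)) ∂(M.pathLaw P π T s) := by
        congr 1 with h
        rw [clipped_of_mem (hM.accCost_mem h)]
        ring
    _ = _ := by
      rw [integral_add (integrable_const _) (integrable_of_abs_le hm fun h => hB _)]
      simp

lemma abs_risk_sub_le (hLC : 0 ≤ L_C) (hLΘ : 0 ≤ L_Θ) (hLπ : 0 ≤ L_π) (hΘ : Θ.Nonempty)
    (hΘR : ∃ z, Θ ⊆ Metric.closedBall z R_Θ)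
    (hf : ∀ θ ∈ Θ, ∀ z z' : ℝ, |f θ z - f θ z'| ≤ L_C * |z - z'|)
    (hfΘ : ∀ θ ∈ Θ, ∀ θ' ∈ Θ, ∀ z : ℝ, |f θ z - f θ' z| ≤ L_Θ * ‖θ - θ'‖)
    (hM : M.Regular T R L) (hπ : π.IsLipschitz T L_π) {s : M.S 0} {ε : ℝ}
    (h : ∀ θ ∈ Θ, |M.stateValue P π (clipped (f θ) (T + 1)) T 0 s 0
      - M.stateValue P' π (clipped (f θ) (T + 1)) T 0 s 0| ≤ ε) :
    |M.risk P π T Θ f s - M.risk P' π T Θ f s| ≤ ε := by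
  have : Nonempty Θ := hΘ.to_subtype
  obtain ⟨θ₀, hθ₀⟩ := hΘ
  obtain ⟨z, hz⟩ := hΘR
  -- Real infima are comparable only if bounded below; boundedness of `Θ` and the Lipschitz
  -- dependence on `θ` control `f θ 0`.
  have hbdd (Q : ∀ t, Measure (Ξ t)) [∀ t, IsProbabilityMeasure (Q t)] :
      BddBelow (Set.range fun θ : Θ => ∫ h, f θ (M.accCost T h) ∂(M.pathLaw Q π T s)) := by
    refine ⟨f θ₀ 0 - L_Θ * (2 * R_Θ) - L_C * (T + 1), ?_⟩
    rintro _ ⟨⟨θ, hθ⟩, rfl⟩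
    simp only
    rw [integral_pathLaw_eq_add_stateValue hLC hLπ (hf θ hθ) hM hπ]
    have h1 := abs_le.1 (abs_stateValue_le (M := M) (P := Q) (π := π)
      (abs_clipped_le (by positivity : (0 : ℝ) ≤ T + 1) hLC (hf θ hθ)) T 0 s 0)
    have h2 := abs_le.1 (hfΘ θ₀ hθ₀ θ hθ 0)
    have h3 : L_Θ * ‖θ₀ - θ‖ ≤ L_Θ * (2 * R_Θ) := by
      gcongr
      rw [← dist_eq_norm]
      linarith [dist_triangle_right θ₀ θ z, Metric.mem_closedBall.1 (hz hθ₀),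
        Metric.mem_closedBall.1 (hz hθ)]
    linarith [h1.1, h2.2]
  refine abs_ciInf_sub_ciInf_le (hbdd P) (hbdd P') fun θ => ?_
  rw [integral_pathLaw_eq_add_stateValue hLC hLπ (hf θ θ.2) hM hπ,
    integral_pathLaw_eq_add_stateValue hLC hLπ (hf θ θ.2) hM hπ, add_sub_add_left_eq_sub]
  exact h θ θ.2

/-- With high probability the empirical one-step expectations of all the value functions
are close to the true ones, uniformly in the state, the action, the accumulated cost and the
parameter of the reward. -/
lemma measureReal_exists_transition_deviation_le {Ω : Type*} [MeasurableSpace Ω] {μ : Measure Ω}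
    [IsProbabilityMeasure μ] {t m n : ℕ} [NeZero n] {ξ : Fin n → Ω → Ξ t}
    (hlaw : ∀ i, HasLaw (ξ i) (P t) μ) (hind : iIndepFun ξ μ) (ht : t + 1 + m = T)
    (hM : M.Regular T R L) (hπ : π.IsLipschitz T L_π) (hLπ : 0 ≤ L_π)
    (hΘR : ∃ z, Θ ⊆ Metric.closedBall z R_Θ) {g : EuclideanSpace ℝ (Fin d) → ℝ → ℝ} {B K_Θ : ℝ}
    (hB0 : 0 < B) (hKΘ : 0 ≤ K_Θ) (hB : ∀ θ ∈ Θ, ∀ z, |g θ z| ≤ B)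
    (hg : ∀ θ ∈ Θ, ∀ z z', |g θ z - g θ z'| ≤ B * |z - z'|)
    (hgΘ : ∀ θ ∈ Θ, ∀ θ' ∈ Θ, ∀ z, |g θ z - g θ' z| ≤ K_Θ * ‖θ - θ'‖)
    {r η ρ : ℝ} (hTr : T ≤ r) (hRr : R ≤ r) (hRΘr : R_Θ ≤ r) (hη : 0 ≤ η) (hρ : 0 < ρ)
    (hηρ : 2 * (3 * (B * growth L L_π ^ (T + 1)) + K_Θ) * ρ ≤ η) :
    μ.real {ω | ∃ θ ∈ Θ, ∃ p : M.S t × M.A t, ∃ x ∈ Set.Icc (0 : ℝ) t, 2 * η <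
      |∫ ζ, M.stateValue P π (g θ) m (t + 1) (M.F t (p, ζ)) (x + M.c t p) ∂(P t)
        - ∫ ζ, M.stateValue P π (g θ) m (t + 1) (M.F t (p, ζ)) (x + M.c t p)
          ∂(empiricalMeasure fun i => ξ i ω)|}
      ≤ (1 + 2 * r / ρ) ^ (dS + (dA + (1 + d))) * (2 * Real.exp (-(n * η ^ 2 / (2 * B ^ 2)))) := by
  have hG := four_le_growth L L_π
  obtain ⟨zS, hzS⟩ := hM.radius_S t (by omega)
  obtain ⟨zA, hzA⟩ := hM.radius_A t (by omega)
  obtain ⟨zΘ, hzΘ⟩ := hΘR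
  have htT : (t : ℝ) ≤ T := by exact_mod_cast (by omega : t ≤ T)
  have hr : 0 ≤ r := (Nat.cast_nonneg T).trans hTr
  -- All four parameters are covered at once, in a product of dimension `dS + (dA + (1 + d))` with
  -- the maximum metric.
  let Z : Set (EuclideanSpace ℝ (Fin dS) × EuclideanSpace ℝ (Fin dA) × ℝ ×
    EuclideanSpace ℝ (Fin d)) := {z | z.1 ∈ M.S t ∧ z.2.1 ∈ M.A t ∧ z.2.2.1 ∈ Set.Icc (0 : ℝ) t ∧
      z.2.2.2 ∈ Θ}
  have hZ : Z ⊆ Metric.closedBall (zS, zA, 0, zΘ) r := by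
    rintro ⟨s, a, x, θ⟩ ⟨hs, ha, hx, hθ⟩
    simp only at hs ha hx hθ
    simp only [Metric.mem_closedBall, Prod.dist_eq, max_le_iff]
    refine ⟨(hzS hs).trans hRr, (hzA ha).trans hRr, ?_, (hzΘ hθ).trans hRΘr⟩
    rw [Real.dist_0_eq_abs, abs_of_nonneg hx.1]
    linarith [hx.2]
  let p (z : Z) : M.S t × M.A t := (⟨z.1.1, z.2.1⟩, ⟨z.1.2.1, z.2.2.1⟩)
  let φ (z : Z) (ζ : Ξ t) : ℝ :=
    M.stateValue P π (g z.1.2.2.2) m (t + 1) (M.F t (p z, ζ)) (z.1.2.2.1 + M.c t (p z))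
  have hφ (z : Z) : Measurable (φ z) :=
    measurable_stateValue_comp hM hπ hLπ hB0.le (hB _ z.2.2.2.2) (hg _ z.2.2.2.2) ht _ _
  have hφB (z : Z) (ζ : Ξ t) : |φ z ζ| ≤ B := abs_stateValue_le (hB _ z.2.2.2.2) _ _ _ _
  have hlip (z z' : Z) (ζ : Ξ t) : |φ z ζ - φ z' ζ|
      ≤ (3 * (B * growth L L_π ^ (T + 1)) + K_Θ) * dist z z' := by
    obtain ⟨⟨s, a, x, θ⟩, hs, ha, hx, hθ⟩ := z
    obtain ⟨⟨s', a', x', θ'⟩, hs', ha', hx', hθ'⟩ := z'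
    simp only at hs ha hx hθ hs' ha' hx' hθ'
    have h1 := abs_stateValue_transition_sub_le (P := P) hM hπ hLπ hB0.le (hB θ hθ) (hg θ hθ) ht
      ⟨s, hs⟩ ⟨s', hs'⟩ ⟨a, ha⟩ ⟨a', ha'⟩ x x' ζ
    have h2 := abs_stateValue_sub_le_of_reward (P := P) hM hπ hLπ hB0.le (hB θ hθ) (hg θ hθ)
      (hB θ' hθ') (hg θ' hθ') (hgΘ θ hθ θ' hθ') ht (M.F t ((⟨s', hs'⟩, ⟨a', ha'⟩), ζ))
      (x' + M.c t (⟨s', hs'⟩, ⟨a', ha'⟩))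
    refine (abs_sub_le _ _ _).trans ((add_le_add h1 h2).trans ?_)
    rw [Subtype.dist_eq, Subtype.dist_eq, Subtype.dist_eq, ← dist_eq_norm, ← Real.dist_eq]
    have hd1 : dist s s' ≤ dist (s, a, x, θ) (s', a', x', θ') := le_max_left _ _
    have hd2 : dist a a' ≤ dist (s, a, x, θ) (s', a', x', θ') :=
      le_max_of_le_right (le_max_left _ _)
    have hd3 : dist x x' ≤ dist (s, a, x, θ) (s', a', x', θ') :=
      le_max_of_le_right (le_max_of_le_right (le_max_left _ _))
    have hd4 : dist θ θ' ≤ dist (s, a, x, θ) (s', a', x', θ') :=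
      le_max_of_le_right (le_max_of_le_right (le_max_right _ _))
    have hpow : growth L L_π ^ (m + 2) ≤ growth L L_π ^ (T + 1) :=
      pow_le_pow_right₀ (by linarith) (by omega)
    calc _ ≤ B * growth L L_π ^ (T + 1) * (3 * dist (s, a, x, θ) (s', a', x', θ'))
          + K_Θ * dist (s, a, x, θ) (s', a', x', θ') := by
          gcongr
          linarith
      _ = _ := by ring
  refine le_trans (measureReal_mono ?_ (measure_ne_top _ _))
    ((measureReal_exists_abs_empirical_sub_gt_le hlaw hind hr hZ hφ hB0 hφB (by positivity) hlip
      hη hρ hηρ).trans_eq ?_)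
  · rintro ω ⟨θ, hθ, ⟨⟨s, hs⟩, ⟨a, ha⟩⟩, x, hx, hω⟩
    exact ⟨⟨(s, a, x, θ), hs, ha, hx, hθ⟩, hω⟩
  · simp only [Module.finrank_prod, finrank_euclideanSpace_fin, Module.finrank_self]

end SOC

/-- The bad event is an uncountable union and need not be measurable; the complement of its
measurable hull is a good event. -/
lemma exists_measurableSet_le_measureReal_disjoint {Ω : Type*} [MeasurableSpace Ω] {μ : Measure Ω}
    [IsProbabilityMeasure μ] {N : Set Ω} {δ : ℝ} (hN : μ.real N ≤ δ) :
    ∃ E : Set Ω, MeasurableSet E ∧ 1 - δ ≤ μ.real E ∧ ∀ ω ∈ E, ω ∉ N := by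
  refine ⟨(toMeasurable μ N)ᶜ, (measurableSet_toMeasurable μ N).compl, ?_,
    fun ω hω hN => hω (subset_toMeasurable μ N hN)⟩
  rw [probReal_compl_eq_one_sub (measurableSet_toMeasurable μ N), measureReal_def,
    measure_toMeasurable, ← measureReal_def]
  linarith

/-! ### The main theorem. -/

theorem mainTheorem5 :
    ∃ C : ℝ, 0 < C ∧
      ∀ (T dS dA d : ℕ) (_ : 0 < dS) (_ : 0 < dA) (_ : 0 < d)
        (Ξ : ℕ → Type*) [∀ t, TopologicalSpace (Ξ t)] [∀ t, MeasurableSpace (Ξ t)]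
        [∀ t, OpensMeasurableSpace (Ξ t)]
        (P : ∀ t, Measure (Ξ t)) [∀ t, IsProbabilityMeasure (P t)]
        (M : SOC dS dA Ξ) (π : M.MarkovPolicy)
        (Θ : Set (EuclideanSpace ℝ (Fin d))) (f : EuclideanSpace ℝ (Fin d) → ℝ → ℝ)
        (L_C L_Θ L L_π R R_Θ : ℝ)
        (_ : 0 ≤ L_C) (_ : 0 ≤ L_Θ) (_ : 0 ≤ L) (_ : 0 ≤ L_π) (_ : 0 ≤ R) (_ : 0 ≤ R_Θ)
        (_ : Θ.Nonempty) (_ : ∃ z, Θ ⊆ Metric.closedBall z R_Θ)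
        (_ : ∀ θ ∈ Θ, ∀ z z' : ℝ, |f θ z - f θ z'| ≤ L_C * |z - z'|)
        (_ : ∀ θ ∈ Θ, ∀ θ' ∈ Θ, ∀ z : ℝ, |f θ z - f θ' z| ≤ L_Θ * ‖θ - θ'‖)
        (_ : M.Regular T R L) (_ : π.IsLipschitz T L_π)
        (ε δ : ℝ) (_ : 0 < ε) (_ : 0 < δ) (_ : δ < 1)
        (n : ℕ) (_ : 0 < n)
        (_ : C * (T ^ 5 * L_C ^ 2 * dS * dA * d / ε ^ 2 *
            Real.log (max 2 (T * max 1 L_C * max 1 L_Θ * max 1 L * max 1 L_π * max 1 R * max 1 R_Θ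
              / (ε * δ)))) ≤ n)
        (Ω : Type*) [MeasurableSpace Ω] (μ : Measure Ω) [IsProbabilityMeasure μ]
        (ξ : ∀ t, Fin n → Ω → Ξ t)
        (_ : ∀ t < T, ∀ i, HasLaw (ξ t i) (P t) μ)
        (_ : ∀ t < T, iIndepFun (ξ t) μ),
        ∃ E : Set Ω, MeasurableSet E ∧ 1 - δ ≤ μ.real E ∧
          ∀ ω ∈ E, ∀ s : M.S 0,
            |M.risk P π T Θ f s
              - M.risk (fun t => empiricalMeasure fun i => ξ t i ω) π T Θ f s| ≤ ε := by
  refine ⟨3200, by norm_num, ?_⟩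
  intro T dS dA d hdS hdA hd Ξ _ _ _ P _ M π Θ f L_C L_Θ L L_π R R_Θ hLC hLΘ _ hLπ _ _ hΘ hΘR hf
    hfΘ hM hπ ε δ hε hδ hδ1 n hn0 hn Ω _ μ _ ξ hlaw hind
  have : NeZero n := ⟨hn0.ne'⟩
  have hb : (0 : ℝ) ≤ T + 1 := by positivity
  have hB0 : 0 ≤ L_C * (T + 1) := by positivity
  have hB (θ) (hθ : θ ∈ Θ) := abs_clipped_le hb hLC (hf θ hθ)
  have hg (θ) (hθ : θ ∈ Θ) (z z' : ℝ) : |clipped (f θ) (T + 1) z - clipped (f θ) (T + 1) z'|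
      ≤ L_C * (T + 1) * |z - z'| :=
    (abs_clipped_sub_le hLC (hf θ hθ) z z').trans (mul_le_mul_of_nonneg_right
      (le_mul_of_one_le_right hLC (by simp)) (abs_nonneg _))
  -- For large `ε` nothing is to be sampled: both values are bounded by `L_C * (T + 1)`.
  rcases le_or_gt (2 * (L_C * (T + 1))) ε with hεL | hεL
  · refine ⟨Set.univ, MeasurableSet.univ, by simp [hδ.le], fun ω _ s => ?_⟩
    refine SOC.abs_risk_sub_le hLC hLΘ hLπ hΘ hΘR hf hfΘ hM hπ fun θ hθ => ?_
    have h1 := SOC.abs_stateValue_le (M := M) (P := P) (π := π) (hB θ hθ) T 0 s 0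
    have h2 := SOC.abs_stateValue_le (M := M) (π := π)
      (P := fun t => empiricalMeasure fun i => ξ t i ω) (hB θ hθ) T 0 s 0
    refine (abs_sub _ _).trans ?_
    linarith
  have hBpos : 0 < L_C * (T + 1) := by linarith
  -- For `T = 0` no noise enters and the two risks agree; the choices below divide by `T`.
  rcases Nat.eq_zero_or_pos T with rfl | hT
  · refine ⟨Set.univ, MeasurableSet.univ, by simp [hδ.le], fun ω _ s => ?_⟩
    refine SOC.abs_risk_sub_le hLC hLΘ hLπ hΘ hΘR hf hfΘ hM hπ fun θ hθ => ?_
    refine (SOC.abs_stateValue_sub_le_of_noise (η := 0) hM hπ hLπ hB0 (hB θ hθ) (hg θ hθ)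
      (fun t m htm => by omega) s).trans ?_
    simpa using hε.le
  have hT0 : (0 : ℝ) < T := by exact_mod_cast hT
  have hT1 : (1 : ℝ) ≤ T := by exact_mod_cast hT
  have hG := SOC.four_le_growth L L_π
  have hK : 0 < 3 * (L_C * (T + 1) * SOC.growth L L_π ^ (T + 1)) + 2 * L_Θ := by positivity
  -- The net radius is chosen so that discretization costs exactly `η = ε / (2 * T)`; a one-step
  -- error `2 * η` over `T` stages then totals `ε`.
  have hρη : 2 * (3 * (L_C * (T + 1) * SOC.growth L L_π ^ (T + 1)) + 2 * L_Θ) * (ε / (4 * T *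
      (3 * (L_C * (T + 1) * SOC.growth L L_π ^ (T + 1)) + 2 * L_Θ))) = ε / (2 * T) := by
    generalize 3 * (L_C * (T + 1) * SOC.growth L L_π ^ (T + 1)) + 2 * L_Θ = K at hK
    field_simp
    norm_num
  have hgΘ : ∀ θ ∈ Θ, ∀ θ' ∈ Θ, ∀ z, |clipped (f θ) (T + 1) z - clipped (f θ') (T + 1) z|
      ≤ 2 * L_Θ * ‖θ - θ'‖ := fun θ hθ θ' hθ' z => by
    rw [mul_assoc]
    exact abs_clipped_sub_clipped_le (hfΘ θ hθ θ' hθ') z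
  let N (t : ℕ) : Set Ω := {ω | ∃ θ ∈ Θ, ∃ p : M.S t × M.A t, ∃ x ∈ Set.Icc (0 : ℝ) t,
    2 * (ε / (2 * T)) < |∫ ζ, M.stateValue P π (clipped (f θ) (T + 1)) (T - (t + 1)) (t + 1)
        (M.F t (p, ζ)) (x + M.c t p) ∂(P t)
      - ∫ ζ, M.stateValue P π (clipped (f θ) (T + 1)) (T - (t + 1)) (t + 1) (M.F t (p, ζ))
        (x + M.c t p) ∂(empiricalMeasure fun i => ξ t i ω)|}
  have hR1 : 1 ≤ max 1 R := le_max_left _ _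
  have hRΘ1 : 1 ≤ max 1 R_Θ := le_max_left _ _
  have hN : μ.real (⋃ t ∈ Finset.range T, N t) ≤ δ := by
    refine (measureReal_biUnion_finset_le _ _).trans ((Finset.sum_le_card_nsmul _ _
      ((1 + 2 * (T * max 1 R * max 1 R_Θ) / (ε / (4 * T *
        (3 * (L_C * (T + 1) * SOC.growth L L_π ^ (T + 1)) + 2 * L_Θ)))) ^ (dS + (dA + (1 + d))) *
        (2 * Real.exp (-(n * (ε / (2 * T)) ^ 2 / (2 * (L_C * (T + 1)) ^ 2)))))
      fun t ht => ?_).trans ?_)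
    · have htT := Finset.mem_range.1 ht
      refine SOC.measureReal_exists_transition_deviation_le (hlaw t htT) (hind t htT)
        (by omega) hM hπ hLπ hΘR hBpos (by positivity) hB hg hgΘ ?_ ?_ ?_ (by positivity)
        (by positivity) hρη.le
      · rw [mul_assoc]
        exact le_mul_of_one_le_right hT0.le (one_le_mul_of_one_le_of_one_le hR1 hRΘ1)
      · calc R ≤ max 1 R := le_max_right _ _
          _ ≤ T * max 1 R := le_mul_of_one_le_left (by positivity) hT1
          _ ≤ _ := le_mul_of_one_le_right (by positivity) hRΘ1
      · calc R_Θ ≤ max 1 R_Θ := le_max_right _ _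
          _ ≤ _ := le_mul_of_one_le_left (by positivity)
            (one_le_mul_of_one_le_of_one_le hT1 hR1)
    · rw [Finset.card_range, nsmul_eq_mul]
      exact failure_probability_le hT hdS hdA hd hLC hLΘ hε hδ hδ1 hεL hn
  obtain ⟨E, hE, hEδ, hEN⟩ := exists_measurableSet_le_measureReal_disjoint hN
  refine ⟨E, hE, hEδ, fun ω hω s => ?_⟩
  refine SOC.abs_risk_sub_le hLC hLΘ hLπ hΘ hΘR hf hfΘ hM hπ fun θ hθ => ?_
  refine (SOC.abs_stateValue_sub_le_of_noise (η := 2 * (ε / (2 * T))) hM hπ hLπ hB0 (hB θ hθ)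
    (hg θ hθ) (fun t m htm p x hx => ?_) s).trans (le_of_eq (by field_simp))
  by_contra! hlt
  refine hEN ω hω (Set.mem_biUnion (Finset.mem_coe.2 (Finset.mem_range.2 (by omega : t < T))) ?_)
  obtain rfl : m = T - (t + 1) := by omega
  exact ⟨θ, hθ, p, x, hx, hlt⟩
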